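/- Conventions. Manifolds are smooth, finite-dimensional and without boundary. On a symplectic manifold $(W,\omega)$ the Hamiltonian vector field of a smooth function $F$ is given by $\omega(X_F,\cdot)=-dF$. A level $F^{-1}(k)$ is called stable if $dF\neq 0$ at each of its points and there is a 1-form $\lambda$, smooth on a neighbourhood of $F^{-1}(k)$, which stabilises it: for every nonzero vector $v$ tangent to the characteristic foliation $\ker(\omega|_{F^{-1}(k)})$ one has $\lambda(v)\neq 0$, and $d\lambda(v,u)=0$ for every $u$ tangent to $F^{-1}(k)$. Cotangent bundles carry the canonical symplectic form $d\xi$, where $\xi$ is the Liouville form ($\xi=p\,dq$); $t$ is the angle on $S^1$, and $(t,p_t)$ are the corresponding coordinates on $T^*S^1$. Let either (a) $M$ be a manifold, $V=T^*M$ and $W=T^*(M\times S^1)$, both with their canonical symplectic forms, or (b) $(V,\omega)$ be an arbitrary symplectic manifold and $W=V\times T^*S^1$ with the symplectic form $\omega\oplus dp_t\wedge dt$, and let $\pi:W\to V$ be the projection, in case (a) $(x,p,t,p_t)\mapsto(x,p)$. Let $H:V\to\mathbb R$ be smooth, and let $\bar H=H\circ\pi+\tfrac12p_t^2:W\to\mathbb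 R$ be its convex suspension. Let $k\in\mathbb R$ and $\delta>0$, and suppose that there is a smooth 1-form $\alpha$ on $H^{-1}(k-\delta,k+\delta)$ such that $i_{X_H}d\alpha=0$ and such that, for each $r\in(k-\delta,k+\delta)$, the function $\alpha(X_H)$ is a positive constant on $H^{-1}(r)$. Then: 1. The level $\bar H^{-1}(k)$ is stable. 2. Let $0<\varepsilon<\sqrt{2\delta}$ be such that the levels $H^{-1}(k-s^2/2)$, $|s|<\varepsilon$, are nonempty, and let $r(s)$ be the value of $\alpha(X_H)$ on $H^{-1}(k-s^2/2)$. Let $f:\mathbb R\to[0,\infty)$ be any smooth even function with support in $(-\varepsilon,\varepsilon)$, with $f=1$ on $(-\varepsilon/2,\varepsilon/2)$ and $f'\le 0$ on $[0,\infty)$. Then $$g(s)=-\int_0^s\frac{r(u)f'(u)}{u}\,du$$ is a smooth function on $\mathbb R$, and the 1-form $f(p_t)\,\pi^*\alpha+g(p_t)\,dt$ (where the first term is extended by zero) stabilises $\bar H^{-1}(k)$. 3. If $H^{-1}(k)$ is nonempty, then such $\varepsilon$, $r$ and $f$ exist. -/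

import Mathlib

open Set Filter Topology Manifold
open scoped ContDiff

noncomputable section

namespace StableSuspension

section Forms

variable {E : Type*} [NormedAddCommGroup E] [NormedSpace ℝ E]
  {B : Type*} [TopologicalSpace B] (I : ModelWithCorners ℝ E B)
  (W : Type*) [TopologicalSpace W] [ChartedSpace B W]
  {E' : Type*} [NormedAddCommGroup E'] [NormedSpace ℝ E']
  {B' : Type*} [TopologicalSpace B'] {I' : ModelWithCorners ℝ E' B'}
  {W' : Type*} [TopologicalSpace W'] [ChartedSpace B' W']

/-- A (not necessarily smooth) differential `n`-form on the manifold `W`. -/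
abbrev Form (n : ℕ) : Type _ := ∀ x : W, (TangentSpace I x) [⋀^Fin n]→L[ℝ] ℝ

variable {I W}

/-- The differential of a real function, as a covector. -/
def differential (F : W → ℝ) (x : W) : TangentSpace I x →L[ℝ] ℝ :=
  mfderiv I 𝓘(ℝ, ℝ) F x

namespace Form

variable {n : ℕ}

/-- The expression of a form in the preferred chart around `x₀`: its pullback under the inverse
of the chart, a form on (an open subset of) the model space `E`. -/
def inChart (σ : Form I W n) (x₀ : W) (y : E) : E [⋀^Fin n]→L[ℝ] ℝ :=
  (σ ((extChartAt I x₀).symm y)).compContinuousLinearMap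
    (mfderiv 𝓘(ℝ, E) I (extChartAt I x₀).symm y : E →L[ℝ] _)

/-- Smoothness on an (open) set, checked in the preferred chart around each of its points. -/
def SmoothOn (σ : Form I W n) (U : Set W) : Prop :=
  ∀ x ∈ U, ContDiffAt ℝ ∞ (σ.inChart x) (extChartAt I x x)

/-- The exterior derivative, computed in the preferred chart around each point. -/
def d (σ : Form I W n) : Form I W (n + 1) := fun x =>
  (extDeriv (σ.inChart x) (extChartAt I x x)).compContinuousLinearMap
    (mfderiv I 𝓘(ℝ, E) (extChartAt I x) x : TangentSpace I x →L[ℝ] E)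

/-- The pullback of a form under a map. -/
def pullback (π : W → W') (σ : Form I' W' n) : Form I W n := fun x =>
  (σ (π x)).compContinuousLinearMap (mfderiv I I' π x)

end Form

/-- The 1-form with the given covectors as values. -/
def oneForm (θ : ∀ x : W, TangentSpace I x →L[ℝ] ℝ) : Form I W 1 := fun x =>
  ContinuousAlternatingMap.ofSubsingleton ℝ (TangentSpace I x) ℝ (0 : Fin 1) (θ x)

end Forms

section Symplectic

variable {E : Type*} [NormedAddCommGroup E] [NormedSpace ℝ E]
  {B : Type*} [TopologicalSpace B] {I : ModelWithCorners ℝ E B}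
  {W : Type*} [TopologicalSpace W] [ChartedSpace B W]

/-- Symplectic forms: smooth, closed and nondegenerate 2-forms. -/
structure IsSymplectic (σ : Form I W 2) : Prop where
  smooth : σ.SmoothOn univ
  closed : σ.d = 0
  nondegenerate : ∀ x, ∀ v : TangentSpace I x,
    (∀ w : TangentSpace I x, σ x ![v, w] = 0) → v = 0

/-- The Hamiltonian vector field `X_F`, determined by `σ(X_F, ·) = -dF`; with `σ = dp ∧ dq` this
gives `q' = ∂F/∂p`, `p' = -∂F/∂q`. -/
def hamVF (σ : Form I W 2) (F : W → ℝ) (x : W) : TangentSpace I x :=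
  Classical.epsilon fun v : TangentSpace I x =>
    ∀ w : TangentSpace I x, σ x ![v, w] = -(differential F x w)

theorem hamVF_spec [FiniteDimensional ℝ E] (σ : Form I W 2) (F : W → ℝ) (x : W)
    (hσ : ∀ v : TangentSpace I x, (∀ w : TangentSpace I x, σ x ![v, w] = 0) → v = 0)
    (w : TangentSpace I x) : σ x ![hamVF σ F x, w] = -(differential F x w) := by
  have : FiniteDimensional ℝ (TangentSpace I x) := inferInstanceAs (FiniteDimensional ℝ E)
  have key : ∃ v : TangentSpace I x,
      ∀ w : TangentSpace I x, σ x ![v, w] = -(differential F x w) := by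
    have h0 : ∀ a b : TangentSpace I x, ![a, b] = Function.update ![a, (0 : TangentSpace I x)] 1 b :=
      fun a b => by
        funext i
        fin_cases i <;> simp
    have h1 : ∀ a b : TangentSpace I x, ![a, b] = Function.update ![(0 : TangentSpace I x), b] 0 a :=
      fun a b => by
        funext i
        fin_cases i <;> simp
    let L : TangentSpace I x →ₗ[ℝ] Module.Dual ℝ (TangentSpace I x) :=
      LinearMap.mk₂ ℝ (fun v w => σ x ![v, w])
        (fun a b c => by rw [h1, h1 a, h1 b]; exact (σ x).map_update_add _ _ _ _)
        (fun r a c => by rw [h1, h1 a]; exact (σ x).map_update_smul _ _ _ _)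
        (fun c a b => by rw [h0, h0 c a, h0 c b]; exact (σ x).map_update_add _ _ _ _)
        (fun r c a => by rw [h0, h0 c a]; exact (σ x).map_update_smul _ _ _ _)
    have hinj : Function.Injective L := by
      rw [← LinearMap.ker_eq_bot, LinearMap.ker_eq_bot']
      intro v hv
      exact hσ v fun w => by simpa [L] using LinearMap.congr_fun hv w
    have hsurj : Function.Surjective L :=
      (LinearMap.injective_iff_surjective_of_finrank_eq_finrank
        (Subspace.dual_finrank_eq).symm).1 hinj
    obtain ⟨v, hv⟩ := hsurj (-(differential F x : TangentSpace I x →L[ℝ] ℝ).toLinearMap)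
    exact ⟨v, fun w => by simpa [L] using LinearMap.congr_fun hv w⟩
  exact Classical.epsilon_spec key w

/-- `v` is tangent to the characteristic foliation of the level set of `F` through `x`, that is,
`v` is in the kernel of the restriction of `σ` to the tangent space `ker dF` of the level. -/
def IsCharacteristic (σ : Form I W 2) (F : W → ℝ) (x : W) (v : TangentSpace I x) : Prop :=
  differential F x v = 0 ∧
    ∀ u : TangentSpace I x, differential F x u = 0 → σ x ![v, u] = 0

/-- The 1-form `θ`, which has to be smooth near the level `F⁻¹(k)`, stabilizes it: the nonzero
vectors tangent to the characteristic foliation annihilate the restriction of `dθ` to the level,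
but not `θ`. -/
def Stabilizes (σ : Form I W 2) (F : W → ℝ) (k : ℝ) (θ : Form I W 1) : Prop :=
  (∃ U : Set W, IsOpen U ∧ F ⁻¹' {k} ⊆ U ∧ θ.SmoothOn U) ∧
    ∀ x, F x = k → ∀ v : TangentSpace I x, IsCharacteristic σ F x v → v ≠ 0 →
      θ x ![v] ≠ 0 ∧
        ∀ u : TangentSpace I x, differential F x u = 0 → θ.d x ![v, u] = 0

/-- `F⁻¹(k)` is a stable hypersurface. -/
def IsStableLevel (σ : Form I W 2) (F : W → ℝ) (k : ℝ) : Prop :=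
  (∀ x, F x = k → (differential F x : TangentSpace I x →L[ℝ] ℝ) ≠ 0) ∧
    ∃ θ : Form I W 1, Stabilizes σ F k θ

/-- `α` is a smooth 1-form on the neighbourhood `F⁻¹(k - δ, k + δ)` of `F⁻¹(k)` with
`i_{X_F} dα = 0` and with `α(X_F)` constant and positive on each level. The values of `α` outside
the neighbourhood are irrelevant. -/
structure IsAdapted (σ : Form I W 2) (F : W → ℝ) (k δ : ℝ) (α : Form I W 1) : Prop where
  smooth : α.SmoothOn (F ⁻¹' Ioo (k - δ) (k + δ))
  contraction : ∀ x ∈ F ⁻¹' Ioo (k - δ) (k + δ), ∀ u : TangentSpace I x,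
    α.d x ![hamVF σ F x, u] = 0
  constant : ∀ r ∈ Ioo (k - δ) (k + δ), ∃ c : ℝ, 0 < c ∧
    ∀ x, F x = r → α x ![hamVF σ F x] = c

/-- `r s` is the value of `α(X_F)` on the level of energy `k - s² / 2`, for `|s| < ε`; in
particular these levels are nonempty. -/
def IsLevelValue (σ : Form I W 2) (F : W → ℝ) (k ε : ℝ) (α : Form I W 1) (r : ℝ → ℝ) : Prop :=
  ∀ s ∈ Ioo (-ε) ε, ∃ x, F x = k - s ^ 2 / 2 ∧ α x ![hamVF σ F x] = r s

end Symplectic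

section Cotangent

variable {E : Type*} [NormedAddCommGroup E] [NormedSpace ℝ E]
  {B : Type*} [TopologicalSpace B] (I : ModelWithCorners ℝ E B)
  (M : Type*) [TopologicalSpace M] [ChartedSpace B M] [IsManifold I ∞ M]

/-- The cotangent bundle `T*M`. -/
abbrev CotangentBundle : Type _ :=
  Bundle.TotalSpace (E →L[ℝ] ℝ)
    (fun x : M => TangentSpace I x →L[ℝ] Bundle.Trivial M ℝ x)

/-- The model of the cotangent bundle. -/
abbrev cotangentModel : ModelWithCorners ℝ (E × (E →L[ℝ] ℝ)) (ModelProd B (E →L[ℝ] ℝ)) :=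
  I.prod 𝓘(ℝ, E →L[ℝ] ℝ)

/-- The covector underlying a point of the cotangent bundle. -/
def CotangentBundle.covector {I : ModelWithCorners ℝ E B} {M : Type*} [TopologicalSpace M]
    [ChartedSpace B M] (P : CotangentBundle I M) : TangentSpace I P.proj →L[ℝ] ℝ := P.2

/-- The Liouville form `p dq` on `T*M`: the covector composed with the differential of the
projection to `M`. -/
def liouville : Form (cotangentModel I) (CotangentBundle I M) 1 :=
  oneForm fun P => P.covector.comp
    (mfderiv (cotangentModel I) I (fun Q : CotangentBundle I M => Q.proj) P)

/-- The canonical symplectic form `dp ∧ dq` on `T*M`. -/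
def canonicalForm : Form (cotangentModel I) (CotangentBundle I M) 2 := (liouville I M).d

end Cotangent

section CircleForms

/-- The unit vector field `∂/∂t` on the circle, `t` being the angle. -/
def ddt (z : Circle) : TangentSpace (𝓡 1) z :=
  (mfderiv 𝓘(ℝ, ℝ) (𝓡 1) (fun s : ℝ => Circle.exp s * z) 0 :
    ℝ →L[ℝ] EuclideanSpace ℝ (Fin 1)) 1

/-- The angular form `dt = Im (z⁻¹ dz)` on the circle. -/
def dt : Form (𝓡 1) Circle 1 :=
  oneForm fun z =>
    (Complex.imCLM.comp (ContinuousLinearMap.mul ℝ ℂ (starRingEnd ℂ (z : ℂ)))).comp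
      (mfderiv (𝓡 1) 𝓘(ℝ, ℂ) (fun w : Circle => (w : ℂ)) z : TangentSpace (𝓡 1) z →L[ℝ] ℂ)

end CircleForms

section Cutoff

/-- The cut-off functions `f`: smooth, even, nonnegative, supported in `(-ε, ε)`, equal to `1` on
`(-ε/2, ε/2)`, and with `f' ≤ 0` on `[0, ∞)`. -/
structure IsCutoff (ε : ℝ) (f : ℝ → ℝ) : Prop where
  smooth : ContDiff ℝ ∞ f
  even : ∀ s, f (-s) = f s
  support : tsupport f ⊆ Ioo (-ε) ε
  nonneg : ∀ s, 0 ≤ f s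
  eq_one : ∀ s ∈ Ioo (-(ε / 2)) (ε / 2), f s = 1
  deriv_nonpos : ∀ s, 0 ≤ s → deriv f s ≤ 0

/-- `g(s) = -∫₀ˢ r(u) f'(u) / u du`. -/
def gFun (r f : ℝ → ℝ) (s : ℝ) : ℝ := -∫ u in (0 : ℝ)..s, r u * deriv f u / u

end Cutoff

/-- The 1-form `f(p_t) π^*α + g(p_t) τ` on a manifold `W` with a map `π : W → V` and a function
`p_t` on `W`. -/
def suspensionForm
    {E : Type*} [NormedAddCommGroup E] [NormedSpace ℝ E]
    {B : Type*} [TopologicalSpace B] {I : ModelWithCorners ℝ E B}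
    {V : Type*} [TopologicalSpace V] [ChartedSpace B V]
    {E' : Type*} [NormedAddCommGroup E'] [NormedSpace ℝ E']
    {B' : Type*} [TopologicalSpace B'] {I' : ModelWithCorners ℝ E' B'}
    {W : Type*} [TopologicalSpace W] [ChartedSpace B' W]
    (f g : ℝ → ℝ) (pt : W → ℝ) (π : W → V) (α : Form I V 1) (τ : Form I' W 1) : Form I' W 1 :=
  fun w => f (pt w) • (Form.pullback π α : Form I' W 1) w + g (pt w) • τ w

section CotangentSuspension

variable {E : Type*} [NormedAddCommGroup E] [NormedSpace ℝ E]
  {B : Type*} [TopologicalSpace B] (I : ModelWithCorners ℝ E B)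
  (M : Type*) [TopologicalSpace M] [ChartedSpace B M] [IsManifold I ∞ M]

/-- The projection `T*(M × S¹) → T*M`, `(x, p, t, p_t) ↦ (x, p)`: restrict the covector to the
tangent space of `M`. -/
def cotProj (P : CotangentBundle (I.prod (𝓡 1)) (M × Circle)) : CotangentBundle I M :=
  ⟨P.proj.1, P.covector.comp
    (ContinuousLinearMap.inl ℝ (TangentSpace I P.proj.1) (TangentSpace (𝓡 1) P.proj.2))⟩

/-- The momentum `p_t` on `T*(M × S¹)`: the value of the covector on `∂/∂t`. -/
def cotMomentum (P : CotangentBundle (I.prod (𝓡 1)) (M × Circle)) : ℝ :=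
  P.covector ((0, ddt P.proj.2) : TangentSpace I P.proj.1 × TangentSpace (𝓡 1) P.proj.2)

/-- The form `dt` on `T*(M × S¹)`. -/
def cotDt : Form (cotangentModel (I.prod (𝓡 1))) (CotangentBundle (I.prod (𝓡 1)) (M × Circle)) 1 :=
  Form.pullback (fun P => P.proj.2) dt

variable {I M}

/-- The convex suspension `H̄(x, p, t, p_t) = H(x, p) + p_t² / 2` on `T*(M × S¹)`. -/
def cotSuspension (H : CotangentBundle I M → ℝ)
    (P : CotangentBundle (I.prod (𝓡 1)) (M × Circle)) : ℝ :=
  H (cotProj I M P) + cotMomentum I M P ^ 2 / 2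

end CotangentSuspension

section ProductSuspension

variable {E : Type*} [NormedAddCommGroup E] [NormedSpace ℝ E]
  {B : Type*} [TopologicalSpace B] {I : ModelWithCorners ℝ E B}
  {V : Type*} [TopologicalSpace V] [ChartedSpace B V]

/-- `T*S¹`. -/
abbrev CotCircle : Type := CotangentBundle (𝓡 1) Circle

/-- The momentum `p_t` on `T*S¹`. -/
def circleMomentum (P : CotCircle) : ℝ := P.covector (ddt P.proj)

/-- The symplectic form `σ ⊕ dp_t ∧ dt` on `V × T*S¹`. -/
def prodForm (σ : Form I V 2) : Form (I.prod (cotangentModel (𝓡 1))) (V × CotCircle) 2 :=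
  Form.pullback Prod.fst σ + Form.pullback Prod.snd (canonicalForm (𝓡 1) Circle)

variable (I V) in
/-- The form `dt` on `V × T*S¹`. -/
def prodDt : Form (I.prod (cotangentModel (𝓡 1))) (V × CotCircle) 1 :=
  Form.pullback (fun w => w.2.proj) dt

/-- The convex suspension `H̄ = H + p_t² / 2` on `V × T*S¹`. -/
def prodSuspension (H : V → ℝ) (w : V × CotCircle) : ℝ :=
  H w.1 + circleMomentum w.2 ^ 2 / 2

end ProductSuspension

end StableSuspension

end

open StableSuspension

/-! Both cases share one geometry, recorded in `IsSuspension`: the differentials of `π` and `p_t`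
together with a closed 1-form `τ = dt` form a frame of `W` in which the symplectic form is `π^*σ +
dp_t ∧ dt`. Everything about levels is proved from that.

Since `dH̄ = π^*dH + p_t dp_t`, the characteristic line of a level is spanned by `X_H + p_t ∂_t`
(`IsSuspension.exists_eq_smul_hamVF`). A characteristic vector `v` therefore has `dπ v = c X_H`,
`dp_t(v) = 0`, `dt(v) = c p_t` with `c ≠ 0`. For `θ = f(p_t) π^*α + g(p_t) dt` this gives `θ(v) = c
(f r + g p_t)` and, because `i_{X_H} dα = 0`, `dθ(v, u) = -c (r f' + p_t g') dp_t(u)`. Stability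
thus amounts to two facts about functions of one variable `s = p_t`: the equation `s g' = -r f'`,
which dictates the integral defining `g`, and `f r + g s ≠ 0` (`IsSuspension.stabilizes`).

The second fact is a sign argument (`IsCutoff.add_mul_gFun_ne_zero`). As `f` is even and decreases
away from `0`, and `r > 0`, the function `g` is nondecreasing with `g(0) = 0`, so `g s ≥ 0`. Where
`f > 0` the term `f r` is positive; where `f = 0`, the function `f` has dropped from `1`, which
forces `g ≠ 0`.

Smoothness of `g` needs smoothness of `r`: `r(s)` is the smooth function `α(X_H)` evaluated along a
curve transverse to the levels of `H` and parametrised by energy (`exists_section`,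
`IsAdapted.contDiffAt_levelValue`). If `H⁻¹(k)` is empty, `p_t` never vanishes on the level of `H̄`
and `dt` alone stabilises it.

It remains to verify the frame. On `V × T*S¹` this comes from `p dq = p_t dt` on the circle, and on
`T*(M × S¹)` from the splitting of the Liouville form in `liouville_prod_circle`. -/

noncomputable section

namespace StableSuspension

/-! ### Preferred charts and the derivatives of their inverses. -/

section Charts

variable {E : Type*} [NormedAddCommGroup E] [NormedSpace ℝ E]
  {B : Type*} [TopologicalSpace B] {I : ModelWithCorners ℝ E B}
  {W : Type*} [TopologicalSpace W] [ChartedSpace B W]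

theorem eventually_symm_extChartAt {x p : W} (hp : p ∈ (extChartAt I x).source)
    {P : W → Prop} (h : ∀ᶠ q in 𝓝 p, P q) :
    ∀ᶠ y in 𝓝 (extChartAt I x p), P ((extChartAt I x).symm y) := by
  have hc := continuousAt_extChartAt_symm' (I := I) hp
  rw [ContinuousAt, (extChartAt I x).left_inv hp] at hc
  exact hc.eventually h

variable [I.Boundaryless] [IsManifold I ∞ W]

theorem mdifferentiableAt_extChartAt_symm {x : W} {y : E} (hy : y ∈ (extChartAt I x).target) :
    MDifferentiableAt 𝓘(ℝ, E) I (extChartAt I x).symm y := by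
  have := mdifferentiableWithinAt_extChartAt_symm (I := I) hy
  rwa [I.range_eq_univ, mdifferentiableWithinAt_univ] at this

theorem mfderiv_extChartAt_mfderiv_symm {x : W} {y : E} (hy : y ∈ (extChartAt I x).target)
    (v : E) :
    mfderiv I 𝓘(ℝ, E) (extChartAt I x) ((extChartAt I x).symm y)
      (mfderiv 𝓘(ℝ, E) I (extChartAt I x).symm y v) = v := by
  have := mfderiv_extChartAt_comp_mfderivWithin_extChartAt_symm (I := I) hy
  rw [I.range_eq_univ, mfderivWithin_univ] at this
  exact DFunLike.congr_fun this v

theorem mfderiv_symm_mfderiv_extChartAt {x p : W} (hp : p ∈ (extChartAt I x).source)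
    (v : TangentSpace I p) :
    (mfderiv 𝓘(ℝ, E) I (extChartAt I x).symm (extChartAt I x p) : E →L[ℝ] E)
      (mfderiv I 𝓘(ℝ, E) (extChartAt I x) p v) = v := by
  have := mfderivWithin_extChartAt_symm_comp_mfderiv_extChartAt' (I := I) hp
  rw [I.range_eq_univ, mfderivWithin_univ] at this
  exact DFunLike.congr_fun this v

/-- The tangent space at `x` is the model space, identified with it through the preferred chart at
`x` itself. -/
theorem mfderiv_extChartAt_symm_self (x : W) :
    (mfderiv 𝓘(ℝ, E) I (extChartAt I x).symm (extChartAt I x x) : E →L[ℝ] E) =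
      ContinuousLinearMap.id ℝ E := by
  have := mfderivWithin_range_extChartAt_symm (I := I) (x := x)
  rw [I.range_eq_univ, mfderivWithin_univ] at this
  exact this

theorem contMDiffAt_extChartAt_symm {x : W} {y : E} (hy : y ∈ (extChartAt I x).target) :
    ContMDiffAt 𝓘(ℝ, E) I ∞ (extChartAt I x).symm y :=
  (contMDiffOn_extChartAt_symm (I := I) x).contMDiffAt ((isOpen_extChartAt_target x).mem_nhds hy)

end Charts

/-! ### Differential forms read in charts. -/

namespace Form

variable {E : Type*} [NormedAddCommGroup E] [NormedSpace ℝ E]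
  {B : Type*} [TopologicalSpace B] {I : ModelWithCorners ℝ E B}
  {W : Type*} [TopologicalSpace W] [ChartedSpace B W]
  {E' : Type*} [NormedAddCommGroup E'] [NormedSpace ℝ E']
  {B' : Type*} [TopologicalSpace B'] {I' : ModelWithCorners ℝ E' B'}
  {W' : Type*} [TopologicalSpace W'] [ChartedSpace B' W'] {n : ℕ}

/-- All tangent spaces are the same type `E`, so the base point can be moved along an equality
without transporting vectors. -/
theorem apply_congr (σ : Form I W n) {p q : W} (h : p = q) (v : Fin n → E) :
    σ p (v : Fin n → TangentSpace I p) = σ q (v : Fin n → TangentSpace I q) := by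
  subst h; rfl

/-- Smoothness of a form at a point, checked in the preferred chart. -/
def SmoothAt (σ : Form I W n) (x : W) : Prop :=
  ContDiffAt ℝ ∞ (σ.inChart x) (extChartAt I x x)

theorem inChart_apply (σ : Form I W n) (x₀ : W) (y : E) (v : Fin n → E) :
    σ.inChart x₀ y v = σ ((extChartAt I x₀).symm y)
      (fun i => mfderiv 𝓘(ℝ, E) I (extChartAt I x₀).symm y (v i)) := rfl

theorem pullback_id (σ : Form I W n) : (pullback id σ : Form I W n) = σ := by
  funext x
  ext v
  change σ x (fun i => mfderiv I I id x (v i)) = σ x v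
  rw [mfderiv_id]; rfl

theorem SmoothAt.add {σ τ : Form I W n} {x : W} (hσ : σ.SmoothAt x) (hτ : τ.SmoothAt x) :
    SmoothAt (σ + τ) x :=
  ContDiffAt.add hσ hτ

theorem inChart_self_apply [I.Boundaryless] [IsManifold I ∞ W] (σ : Form I W n) (x : W)
    (v : Fin n → E) :
    σ.inChart x (extChartAt I x x) v = σ x (v : Fin n → TangentSpace I x) := by
  rw [inChart_apply]
  refine Eq.trans ?_ (σ.apply_congr (extChartAt_to_inv (I := I) x) v)
  congr 1
  funext i
  exact DFunLike.congr_fun (mfderiv_extChartAt_symm_self (I := I) x) (v i)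

theorem inChart_eventuallyEq [I.Boundaryless] [IsManifold I ∞ W] {σ τ : Form I W n} {x₀ x : W}
    (hx : x ∈ (extChartAt I x₀).source)
    (h : ∀ᶠ y in 𝓝 x, σ y = τ y) : σ.inChart x₀ =ᶠ[𝓝 (extChartAt I x₀ x)] τ.inChart x₀ := by
  filter_upwards [eventually_symm_extChartAt hx h] with y hy
  rw [inChart, inChart, hy]

theorem SmoothAt.congr [I.Boundaryless] [IsManifold I ∞ W] {σ τ : Form I W n} {x : W}
    (hσ : σ.SmoothAt x) (h : ∀ᶠ y in 𝓝 x, σ y = τ y) : τ.SmoothAt x :=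
  ContDiffAt.congr_of_eventuallyEq hσ
    (inChart_eventuallyEq (mem_extChartAt_source x) h).symm

theorem d_congr [I.Boundaryless] [IsManifold I ∞ W] {σ τ : Form I W n} {x : W}
    (h : ∀ᶠ y in 𝓝 x, σ y = τ y) : σ.d x = τ.d x := by
  unfold d
  rw [(inChart_eventuallyEq (mem_extChartAt_source x) h).extDeriv_eq]

theorem d_apply [I.Boundaryless] [IsManifold I ∞ W] (σ : Form I W n) (x : W)
    (v : Fin (n + 1) → TangentSpace I x) :
    σ.d x v = extDeriv (σ.inChart x) (extChartAt I x x) (v : Fin (n + 1) → E) := by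
  change extDeriv (σ.inChart x) (extChartAt I x x)
    (fun i => mfderiv I 𝓘(ℝ, E) (extChartAt I x) x (v i)) = _
  congr 1
  funext i
  exact DFunLike.congr_fun (mfderiv_extChartAt_self (I := I) (x := x)) (v i)

/-- This is the chain rule for `π` read in charts. The charts need not be centred at `x` and `π x`;
this freedom is what later yields independence of the chart. -/
theorem inChart_pullback_eventuallyEq [I.Boundaryless] [IsManifold I ∞ W] [I'.Boundaryless]
    [IsManifold I' ∞ W'] {π : W → W'} (σ : Form I' W' n) {x₀ x : W} {x₀' : W'}
    (hx : x ∈ (extChartAt I x₀).source) (hx' : π x ∈ (extChartAt I' x₀').source)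
    (hπ : ContMDiffAt I I' ∞ π x) :
    (pullback π σ : Form I W n).inChart x₀ =ᶠ[𝓝 (extChartAt I x₀ x)] fun y =>
      (σ.inChart x₀' ((extChartAt I' x₀' ∘ π ∘ (extChartAt I x₀).symm) y)).compContinuousLinearMap
        (fderiv ℝ (extChartAt I' x₀' ∘ π ∘ (extChartAt I x₀).symm) y) := by
  have h1 : ∀ᶠ q in 𝓝 x, MDifferentiableAt I I' π q :=
    (contMDiffAt_iff_contMDiffAt_nhds (n := 1) (by simp)).1 (hπ.of_le (by simp)) |>.mono
      fun q hq => hq.mdifferentiableAt (by simp)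
  have h2 : ∀ᶠ q in 𝓝 x, ∀ᶠ z in 𝓝 q, π z ∈ (extChartAt I' x₀').source :=
    (hπ.continuousAt.eventually_mem (extChartAt_source_mem_nhds' hx')).eventually_nhds
  have h3 : ∀ᶠ y in 𝓝 (extChartAt I x₀ x), y ∈ (extChartAt I x₀).target :=
    extChartAt_target_mem_nhds' ((extChartAt I x₀).map_source hx)
  filter_upwards [eventually_symm_extChartAt hx h1, eventually_symm_extChartAt hx h2, h3]
    with y hy1 hy2 hy3
  have e : (extChartAt I' x₀').symm ∘ (extChartAt I' x₀' ∘ π ∘ (extChartAt I x₀).symm) =ᶠ[𝓝 y]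
      π ∘ (extChartAt I x₀).symm := by
    have := (continuousAt_extChartAt_symm'' (I := I) hy3).eventually hy2
    filter_upwards [this] with z hz
    exact (extChartAt I' x₀').left_inv hz
  have hs := mdifferentiableAt_extChartAt_symm (I := I) hy3
  have hmem := hy2.self_of_nhds
  have hc : MDifferentiableAt I' 𝓘(ℝ, E') (extChartAt I' x₀') (π ((extChartAt I x₀).symm y)) :=
    mdifferentiableAt_extChartAt (by rwa [extChartAt_source] at hmem)
  have hcomp : MDifferentiableAt 𝓘(ℝ, E) 𝓘(ℝ, E')
      (extChartAt I' x₀' ∘ π ∘ (extChartAt I x₀).symm) y :=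
    hc.comp y (hy1.comp y hs)
  have d1 := mfderiv_comp y (mdifferentiableAt_extChartAt_symm (I := I')
    ((extChartAt I' x₀').map_source hmem)) hcomp
  have d2 := mfderiv_comp y hy1 hs
  have d3 := e.mfderiv_eq (I := 𝓘(ℝ, E)) (I' := I')
  rw [mfderiv_eq_fderiv] at d1
  ext v
  change σ (π ((extChartAt I x₀).symm y)) (fun i => mfderiv I I' π ((extChartAt I x₀).symm y)
      (mfderiv 𝓘(ℝ, E) I (extChartAt I x₀).symm y (v i))) =
    σ ((extChartAt I' x₀').symm (extChartAt I' x₀' (π ((extChartAt I x₀).symm y))))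
      (fun i => mfderiv 𝓘(ℝ, E') I' (extChartAt I' x₀').symm
        ((extChartAt I' x₀' ∘ π ∘ (extChartAt I x₀).symm) y)
        (fderiv ℝ (extChartAt I' x₀' ∘ π ∘ (extChartAt I x₀).symm) y (v i)))
  refine Eq.trans ?_ (σ.apply_congr ((extChartAt I' x₀').left_inv hmem).symm _)
  congr 1
  funext i
  exact (DFunLike.congr_fun d2 (v i)).symm.trans
    ((DFunLike.congr_fun d3 (v i)).symm.trans (DFunLike.congr_fun d1 (v i)))

end Form

/-! ### Naturality of the exterior derivative and the Leibniz rule. -/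

namespace Form

section Apply

variable {E : Type*} [NormedAddCommGroup E] [NormedSpace ℝ E]
  {B : Type*} [TopologicalSpace B] {I : ModelWithCorners ℝ E B}
  {W : Type*} [TopologicalSpace W] [ChartedSpace B W]
  {E' : Type*} [NormedAddCommGroup E'] [NormedSpace ℝ E']
  {B' : Type*} [TopologicalSpace B'] {I' : ModelWithCorners ℝ E' B'}
  {W' : Type*} [TopologicalSpace W'] [ChartedSpace B' W']

theorem pullback_apply_one (π : W → W') (σ : Form I' W' 1) (x : W) (v : TangentSpace I x) :
    (pullback π σ : Form I W 1) x ![v] = σ (π x) ![mfderiv I I' π x v] := by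
  change σ (π x) _ = _
  congr 1
  funext i
  fin_cases i; rfl

theorem pullback_apply_two (π : W → W') (σ : Form I' W' 2) (x : W) (v w : TangentSpace I x) :
    (pullback π σ : Form I W 2) x ![v, w] =
      σ (π x) ![mfderiv I I' π x v, mfderiv I I' π x w] := by
  change σ (π x) _ = _
  congr 1
  funext i
  fin_cases i <;> rfl

theorem add_apply {n : ℕ} (σ τ : Form I W n) (x : W) (v : Fin n → TangentSpace I x) :
    (σ + τ) x v = σ x v + τ x v := rfl

theorem smul_apply {n : ℕ} (h : W → ℝ) (σ : Form I W n) (x : W) (v : Fin n → TangentSpace I x) :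
    (fun w => h w • σ w : Form I W n) x v = h x * σ x v := rfl

theorem ext_one {σ τ : Form I W 1} {x : W}
    (h : ∀ v : TangentSpace I x, σ x ![v] = τ x ![v]) : σ x = τ x := by
  ext v
  have e : v = ![v 0] := by
    funext i
    fin_cases i; rfl
  rw [e]
  exact h (v 0)

end Apply

variable {E : Type*} [NormedAddCommGroup E] [NormedSpace ℝ E]
  {B : Type*} [TopologicalSpace B] {I : ModelWithCorners ℝ E B} [I.Boundaryless]
  {W : Type*} [TopologicalSpace W] [ChartedSpace B W] [IsManifold I ∞ W]
  {E' : Type*} [NormedAddCommGroup E'] [NormedSpace ℝ E']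
  {B' : Type*} [TopologicalSpace B'] {I' : ModelWithCorners ℝ E' B'}
  {W' : Type*} [TopologicalSpace W'] [ChartedSpace B' W'] [IsManifold I' ∞ W'] {n : ℕ}

theorem contDiffAt_writtenInCharts {π : W → W'} {x₀ x : W} {x₀' : W'}
    (hx : x ∈ (extChartAt I x₀).source) (hx' : π x ∈ (extChartAt I' x₀').source)
    (hπ : ContMDiffAt I I' ∞ π x) :
    ContDiffAt ℝ ∞ (extChartAt I' x₀' ∘ π ∘ (extChartAt I x₀).symm) (extChartAt I x₀ x) := by
  rw [extChartAt_source] at hx'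
  have h1 : ContMDiffAt 𝓘(ℝ, E) I ∞ (extChartAt I x₀).symm (extChartAt I x₀ x) :=
    contMDiffAt_extChartAt_symm ((extChartAt I x₀).map_source hx)
  have e : (extChartAt I x₀).symm (extChartAt I x₀ x) = x := (extChartAt I x₀).left_inv hx
  have h2 : ContMDiffAt I I' ∞ π ((extChartAt I x₀).symm (extChartAt I x₀ x)) := by rwa [e]
  have h3 : ContMDiffAt I' 𝓘(ℝ, E') ∞ (extChartAt I' x₀')
      (π ((extChartAt I x₀).symm (extChartAt I x₀ x))) := by
    rw [e]; exact contMDiffAt_extChartAt' hx'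
  exact (ContMDiffAt.comp (extChartAt I x₀ x) (g := extChartAt I' x₀') h3
    (ContMDiffAt.comp (extChartAt I x₀ x) (g := π) h2 h1)).contDiffAt

variable [I'.Boundaryless]

/-- In degree one an alternating map is a linear map, and the pullback becomes a composition of
linear maps, which is bilinear and continuous. -/
theorem contDiffAt_compContinuousLinearMap {G F F' : Type*} [NormedAddCommGroup G]
    [NormedSpace ℝ G] [NormedAddCommGroup F] [NormedSpace ℝ F] [NormedAddCommGroup F']
    [NormedSpace ℝ F'] {ω₁ : G → F [⋀^Fin 1]→L[ℝ] ℝ} {A : G → F' →L[ℝ] F} {y : G}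
    (h1 : ContDiffAt ℝ ∞ ω₁ y) (h2 : ContDiffAt ℝ ∞ A y) :
    ContDiffAt ℝ ∞ (fun z => (ω₁ z).compContinuousLinearMap (A z)) y := by
  let L := ContinuousAlternatingMap.ofSubsingletonLIE (𝕜 := ℝ) (E := F) (F := ℝ) (0 : Fin 1)
  let L' := ContinuousAlternatingMap.ofSubsingletonLIE (𝕜 := ℝ) (E := F') (F := ℝ) (0 : Fin 1)
  have e : (fun z => (ω₁ z).compContinuousLinearMap (A z)) =
      fun z => L' ((L.symm (ω₁ z)).comp (A z)) := by
    funext z; ext v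
    change ω₁ z _ = ω₁ z _
    congr 1
    funext i
    fin_cases i; rfl
  rw [e]
  exact L'.contDiff.contDiffAt.comp y ((L.symm.contDiff.contDiffAt.comp y h1).clm_comp h2)

theorem contDiffAt_inChart_pullback {π : W → W'} {σ : Form I' W' 1} {x₀ x : W} {x₀' : W'}
    (hx : x ∈ (extChartAt I x₀).source) (hx' : π x ∈ (extChartAt I' x₀').source)
    (hπ : ContMDiffAt I I' ∞ π x)
    (hσ : ContDiffAt ℝ ∞ (σ.inChart x₀') (extChartAt I' x₀' (π x))) :
    ContDiffAt ℝ ∞ ((pullback π σ : Form I W 1).inChart x₀) (extChartAt I x₀ x) := by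
  refine ContDiffAt.congr_of_eventuallyEq ?_ (inChart_pullback_eventuallyEq σ hx hx' hπ)
  have hc := contDiffAt_writtenInCharts hx hx' hπ
  have e : (extChartAt I x₀).symm (extChartAt I x₀ x) = x := (extChartAt I x₀).left_inv hx
  have h1 : ContDiffAt ℝ ∞ (fun y => σ.inChart x₀'
      ((extChartAt I' x₀' ∘ π ∘ (extChartAt I x₀).symm) y)) (extChartAt I x₀ x) := by
    refine ContDiffAt.comp (extChartAt I x₀ x) (g := σ.inChart x₀') ?_ hc
    simpa only [Function.comp_apply, e] using hσ
  have h2 := hc.fderiv_right (m := ∞) (by simp)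
  exact contDiffAt_compContinuousLinearMap h1 h2

theorem extDeriv_inChart_pullback {π : W → W'} {σ : Form I' W' n} {x₀ x : W} {x₀' : W'}
    (hx : x ∈ (extChartAt I x₀).source) (hx' : π x ∈ (extChartAt I' x₀').source)
    (hπ : ContMDiffAt I I' ∞ π x)
    (hσ : ContDiffAt ℝ ∞ (σ.inChart x₀') (extChartAt I' x₀' (π x))) :
    extDeriv ((pullback π σ : Form I W n).inChart x₀) (extChartAt I x₀ x) =
      (extDeriv (σ.inChart x₀') (extChartAt I' x₀' (π x))).compContinuousLinearMap
        (fderiv ℝ (extChartAt I' x₀' ∘ π ∘ (extChartAt I x₀).symm) (extChartAt I x₀ x)) := by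
  have e : (extChartAt I x₀).symm (extChartAt I x₀ x) = x := (extChartAt I x₀).left_inv hx
  rw [(inChart_pullback_eventuallyEq σ hx hx' hπ).extDeriv_eq]
  have hσ' : DifferentiableAt ℝ (σ.inChart x₀')
      ((extChartAt I' x₀' ∘ π ∘ (extChartAt I x₀).symm) (extChartAt I x₀ x)) := by
    simpa only [Function.comp_apply, e] using hσ.differentiableAt (by simp)
  have := extDeriv_pullback (r := ∞) hσ' (contDiffAt_writtenInCharts hx hx' hπ)
    (by rw [minSmoothness_of_isRCLikeNormedField]; exact ENat.LEInfty.out)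
  simpa only [Function.comp_apply, e] using this

theorem SmoothAt.pullback {π : W → W'} {σ : Form I' W' 1} {x : W}
    (hσ : σ.SmoothAt (π x)) (hπ : ContMDiffAt I I' ∞ π x) :
    (Form.pullback π σ : Form I W 1).SmoothAt x :=
  contDiffAt_inChart_pullback (mem_extChartAt_source x) (mem_extChartAt_source (π x)) hπ hσ

theorem d_pullback {π : W → W'} {σ : Form I' W' n} {x : W}
    (hσ : σ.SmoothAt (π x)) (hπ : ContMDiffAt I I' ∞ π x) :
    (pullback π σ : Form I W n).d x = (pullback π σ.d : Form I W (n + 1)) x := by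
  ext v
  rw [d_apply, extDeriv_inChart_pullback (mem_extChartAt_source x) (mem_extChartAt_source (π x))
    hπ hσ]
  refine Eq.trans ?_ (d_apply σ (π x) (fun i => mfderiv I I' π x (v i))).symm
  change extDeriv _ _ _ = _
  congr 1
  funext i
  have h := (hπ.mdifferentiableAt (by simp)).mfderiv
  rw [I.range_eq_univ, fderivWithin_univ] at h
  exact (DFunLike.congr_fun h (v i)).symm

/-- The definition of `d` uses a different chart at each point. Naturality for the identity map,
read from the chart at `x₀` to the chart at `x`, shows that one fixed chart computes `d` at all
nearby points, as smoothness of `d` requires. -/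
theorem inChart_d_apply {σ : Form I W n} {x₀ x : W} (hx : x ∈ (extChartAt I x₀).source)
    (hσ : σ.SmoothAt x) (v : Fin (n + 1) → E) :
    σ.d.inChart x₀ (extChartAt I x₀ x) v = extDeriv (σ.inChart x₀) (extChartAt I x₀ x) v := by
  have e : (extChartAt I x₀).symm (extChartAt I x₀ x) = x := (extChartAt I x₀).left_inv hx
  have h := extDeriv_inChart_pullback (π := (id : W → W)) hx (mem_extChartAt_source (I := I) x)
      contMDiffAt_id hσ
  rw [pullback_id] at h
  rw [h, inChart_apply]
  refine (σ.d.apply_congr e _).trans ((d_apply σ x _).trans ?_)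
  change _ = extDeriv _ _ _
  congr 1
  funext i
  have hm := mfderiv_comp (I' := I) (extChartAt I x₀ x)
    (by rw [e]; exact mdifferentiableAt_extChartAt (mem_chart_source B x))
    (mdifferentiableAt_extChartAt_symm (I := I) ((extChartAt I x₀).map_source hx))
    (g := extChartAt I x)
  rw [mfderiv_eq_fderiv] at hm
  refine Eq.trans ?_ (DFunLike.congr_fun hm (v i)).symm
  have key : ∀ q, q = x → ∀ w : E, (mfderiv I 𝓘(ℝ, E) (extChartAt I x) q : E →L[ℝ] E) w = w := by
    rintro q rfl w
    exact DFunLike.congr_fun (mfderiv_extChartAt_self (I := I)) w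
  exact (key _ e _).symm

theorem SmoothOn.d {σ : Form I W n} {U : Set W} (hU : IsOpen U) (hσ : σ.SmoothOn U) :
    σ.d.SmoothOn U := by
  intro x hx
  have e : σ.d.inChart x =ᶠ[𝓝 (extChartAt I x x)] extDeriv (σ.inChart x) := by
    have h1 : ∀ᶠ y in 𝓝 (extChartAt I x x), y ∈ (extChartAt I x).target :=
      extChartAt_target_mem_nhds x
    filter_upwards [eventually_symm_extChartAt (mem_extChartAt_source x) (hU.mem_nhds hx), h1]
      with y hy hy'
    ext v
    have := inChart_d_apply (I := I) ((extChartAt I x).map_target hy') (hσ _ hy) v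
    rwa [(extChartAt I x).right_inv hy'] at this
  refine ContDiffAt.congr_of_eventuallyEq ?_ e
  have h2 := (ContDiffAt.fderiv_right (m := ∞) (hσ x hx) (by simp))
  exact (ContinuousAlternatingMap.alternatizeUncurryFinCLM ℝ E ℝ).contDiff.contDiffAt.comp _ h2

theorem d_add {σ τ : Form I W n} {x : W} (hσ : σ.SmoothAt x) (hτ : τ.SmoothAt x) :
    d (σ + τ) x = σ.d x + τ.d x := by
  ext v
  rw [d_apply]
  refine Eq.trans ?_ (congrArg₂ (· + ·) (d_apply σ x v) (d_apply τ x v)).symm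
  have : (σ + τ).inChart x = σ.inChart x + τ.inChart x := by
    funext y; ext v; rfl
  rw [this, extDeriv_add (ContDiffAt.differentiableAt hσ (by simp))
    (ContDiffAt.differentiableAt hτ (by simp))]
  rfl

theorem SmoothAt.smul {h : W → ℝ} {σ : Form I W n} {x : W} (hh : ContMDiffAt I 𝓘(ℝ, ℝ) ∞ h x)
    (hσ : σ.SmoothAt x) : SmoothAt (fun w => h w • σ w : Form I W n) x := by
  have h1 : ContDiffAt ℝ ∞ (h ∘ (extChartAt I x).symm) (extChartAt I x x) :=
    contDiffAt_writtenInCharts (x₀' := h x) (mem_extChartAt_source x) (by simp) hh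
  exact ContDiffAt.smul h1 hσ

theorem extDeriv_smul_apply_one {F : Type*} [NormedAddCommGroup F] [NormedSpace ℝ F] {f : F → ℝ}
    {ω₁ : F → F [⋀^Fin 1]→L[ℝ] ℝ} {y : F} (hf : DifferentiableAt ℝ f y)
    (hω : DifferentiableAt ℝ ω₁ y) (v u : F) :
    extDeriv (f • ω₁) y ![v, u] =
      fderiv ℝ f y v * ω₁ y ![u] - fderiv ℝ f y u * ω₁ y ![v] + f y * extDeriv ω₁ y ![v, u] := by
  have r0 : Fin.removeNth 0 ![v, u] = ![u] := by ext i; fin_cases i; rfl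
  have r1 : Fin.removeNth 1 ![v, u] = ![v] := by ext i; fin_cases i; rfl
  have hm (w : Fin 1 → F) (z : F) : fderiv ℝ (fun x => (f • ω₁) x w) y z =
      f y * fderiv ℝ (fun x => ω₁ x w) y z + fderiv ℝ f y z * ω₁ y w := by
    have hw : DifferentiableAt ℝ (fun x => ω₁ x w) y :=
      (ContinuousAlternatingMap.apply ℝ F ℝ w).differentiableAt.comp y hω
    have : (fun x => (f • ω₁) x w) = f * fun x => ω₁ x w := rfl
    rw [this, fderiv_mul hf hw]
    simp [mul_comm]
  rw [extDeriv_apply (hf.smul hω), extDeriv_apply hω, Fin.sum_univ_two, Fin.sum_univ_two, hm, hm,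
    r0, r1]
  simp
  ring

theorem d_smul_apply {h : W → ℝ} {σ : Form I W 1} {x : W} (hh : ContMDiffAt I 𝓘(ℝ, ℝ) ∞ h x)
    (hσ : σ.SmoothAt x) (v u : TangentSpace I x) :
    d (I := I) (n := 1) (fun w => h w • σ w) x ![v, u] =
      differential h x v * σ x ![u] - differential h x u * σ x ![v] + h x * σ.d x ![v, u] := by
  have h1 : ContDiffAt ℝ ∞ (h ∘ (extChartAt I x).symm) (extChartAt I x x) :=
    contDiffAt_writtenInCharts (x₀' := h x) (mem_extChartAt_source x) (by simp) hh
  have hd1 := h1.differentiableAt (by simp)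
  have hd2 := ContDiffAt.differentiableAt hσ (by simp)
  have e : Form.inChart (I := I) (n := 1) (fun w => h w • σ w) x =
      (h ∘ (extChartAt I x).symm) • σ.inChart x := rfl
  have hdh : ∀ w : E, fderiv ℝ (h ∘ (extChartAt I x).symm) (extChartAt I x x) w =
      differential (I := I) h x w := by
    intro w
    have h := (hh.mdifferentiableAt (by simp)).mfderiv
    rw [I.range_eq_univ, fderivWithin_univ] at h
    exact (DFunLike.congr_fun h w).symm
  have hx : (extChartAt I x).symm (extChartAt I x x) = x := extChartAt_to_inv (I := I) x
  have s : ∀ w : E, σ.inChart x (extChartAt I x x) ![w] = σ x ![(w : TangentSpace I x)] := by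
    intro w
    refine (inChart_self_apply σ x ![w]).trans ?_
    congr 1
  refine (d_apply _ x _).trans ?_
  rw [e]
  refine (extDeriv_smul_apply_one hd1 hd2 v u).trans ?_
  exact congrArg₂ (· + ·)
    (congrArg₂ (· - ·) (congrArg₂ (· * ·) (hdh v) (s u)) (congrArg₂ (· * ·) (hdh u) (s v)))
    (congrArg₂ (· * ·) (congrArg h hx) (d_apply σ x ![v, u]).symm)

end Form

/-! ### Linear algebra of the characteristic line. -/

section LinearAlgebra

/-- Pointwise model: `A`, `b`, `c` are `dπ`, `dp_t`, `dt`. Testing `v` against `∂_t` gives `b v =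
0`. If `p ≠ 0`, every `w` lifts to the kernel of `dH̄` by giving it the `p_t`-component `-h w / p`,
and nondegeneracy identifies `A v`. If `p = 0`, then `∂_{p_t}` is tangent to the level and kills `c
v`, while `A v` is `S`-orthogonal to `ker h` and so is proportional to `X`. -/
theorem exists_eq_smul_of_characteristic {T T' : Type*} [AddCommGroup T] [Module ℝ T]
    [AddCommGroup T'] [Module ℝ T'] (S : T →ₗ[ℝ] T →ₗ[ℝ] ℝ)
    (hS : ∀ v, (∀ w, S v w = 0) → v = 0) (X : T) (h : T →ₗ[ℝ] ℝ) (hX : ∀ w, S X w = -h w)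
    (p : ℝ) (hp : p = 0 → h ≠ 0) (A : T' →ₗ[ℝ] T) (b c : T' → ℝ)
    (hsurj : ∀ a s t, ∃ u, A u = a ∧ b u = s ∧ c u = t) (v : T')
    (hv : h (A v) + p * b v = 0)
    (hker : ∀ u, h (A u) + p * b u = 0 → S (A v) (A u) + b v * c u - c v * b u = 0) :
    ∃ k : ℝ, A v = k • X ∧ b v = 0 ∧ c v = k * p := by
  have hb : b v = 0 := by
    obtain ⟨u, hu1, hu2, hu3⟩ := hsurj 0 0 1
    have := hker u (by rw [hu1, hu2]; simp)
    simpa [hu1, hu2, hu3] using this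
  have hh : h (A v) = 0 := by simpa [hb] using hv
  by_cases hp0 : p = 0
  · have hc : c v = 0 := by
      obtain ⟨u, hu1, hu2, hu3⟩ := hsurj 0 1 0
      have := hker u (by rw [hu1, hp0]; simp)
      simpa [hu1, hu2, hu3] using this
    have hz : ∀ w, h w = 0 → S (A v) w = 0 := by
      intro w hw
      obtain ⟨u, hu1, hu2, hu3⟩ := hsurj w 0 0
      have := hker u (by rw [hu1, hw, hp0]; simp)
      simpa [hu1, hu2, hu3] using this
    obtain ⟨w₀, hw₀⟩ : ∃ w₀, h w₀ ≠ 0 := by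
      by_contra! hcon
      exact hp hp0 (LinearMap.ext hcon)
    -- The coefficient is forced by evaluating at `w₀`, since `S X w₀ = -h w₀`.
    refine ⟨-(S (A v) w₀ / h w₀), ?_, hb, by rw [hc, hp0, mul_zero]⟩
    rw [← sub_eq_zero]
    refine hS _ fun w => ?_
    have := hz (w - (h w / h w₀) • w₀) (by simp [hw₀])
    simp only [map_sub, map_smul, smul_eq_mul, LinearMap.sub_apply, LinearMap.smul_apply, hX,
      map_neg, neg_smul, LinearMap.neg_apply] at this ⊢
    field_simp at this ⊢
    linarith
  · refine ⟨c v / p, ?_, hb, by field_simp⟩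
    rw [← sub_eq_zero]
    refine hS _ fun w => ?_
    obtain ⟨u, hu1, hu2, hu3⟩ := hsurj w (-h w / p) 0
    have := hker u (by rw [hu1, hu2]; field_simp; ring)
    simp only [hu1, hu2, hb, zero_mul, add_zero] at this
    simp only [map_sub, map_smul, LinearMap.sub_apply, LinearMap.smul_apply, hX, smul_eq_mul]
    field_simp at this ⊢
    linarith

/-- The bilinear form underlying an alternating one. -/
def bilin {T : Type*} [AddCommGroup T] [Module ℝ T] [TopologicalSpace T] (η : T [⋀^Fin 2]→L[ℝ] ℝ) :
    T →ₗ[ℝ] T →ₗ[ℝ] ℝ :=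
  have h0 : ∀ a b : T, ![a, b] = Function.update ![a, (0 : T)] 1 b := fun a b => by
    funext i
    fin_cases i <;> simp
  have h1 : ∀ a b : T, ![a, b] = Function.update ![(0 : T), b] 0 a := fun a b => by
    funext i
    fin_cases i <;> simp
  LinearMap.mk₂ ℝ (fun v w => η ![v, w])
    (fun a b c => by rw [h1, h1 a, h1 b]; exact η.map_update_add _ _ _ _)
    (fun r a c => by rw [h1, h1 a]; exact η.map_update_smul _ _ _ _)
    (fun c a b => by rw [h0, h0 c a, h0 c b]; exact η.map_update_add _ _ _ _)
    (fun r c a => by rw [h0, h0 c a]; exact η.map_update_smul _ _ _ _)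

theorem bilin_apply {T : Type*} [AddCommGroup T] [Module ℝ T] [TopologicalSpace T]
    (η : T [⋀^Fin 2]→L[ℝ] ℝ) (v w : T) : bilin η v w = η ![v, w] := rfl

theorem finrank_strongDual (F : Type*) [NormedAddCommGroup F] [NormedSpace ℝ F]
    [FiniteDimensional ℝ F] : Module.finrank ℝ (F →L[ℝ] ℝ) = Module.finrank ℝ F := by
  rw [← (LinearMap.toContinuousLinearMap (𝕜 := ℝ) (E := F) (F' := ℝ)).finrank_eq]
  exact Subspace.dual_finrank_eq

theorem alternating_one_smul {T : Type*} [AddCommGroup T] [Module ℝ T] [TopologicalSpace T]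
    (η : T [⋀^Fin 1]→L[ℝ] ℝ) (c : ℝ) (v : T) : η ![c • v] = c * η ![v] := by
  have h : ∀ w : T, ![w] = Function.update ![(0 : T)] 0 w := fun w => by
    funext i
    fin_cases i; simp
  rw [h, h v]
  exact η.map_update_smul _ _ _ _

end LinearAlgebra

/-! ### Abstract convex suspensions and their characteristic direction. -/

section Suspension

variable {E : Type*} [NormedAddCommGroup E] [NormedSpace ℝ E]
  {B : Type*} [TopologicalSpace B] {I : ModelWithCorners ℝ E B}
  {V : Type*} [TopologicalSpace V] [ChartedSpace B V]
  {E' : Type*} [NormedAddCommGroup E'] [NormedSpace ℝ E']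
  {B' : Type*} [TopologicalSpace B'] {I' : ModelWithCorners ℝ E' B'}
  {W : Type*} [TopologicalSpace W] [ChartedSpace B' W]

/-- `W` looks like the product of `V` with the cotangent bundle of the circle: the map `π`, the
function `pt` and the closed 1-form `τ` are a frame in which the 2-form on `W` is
`π^*σ + d(pt) ∧ τ`. -/
structure IsSuspension (σ : Form I V 2) (σ' : Form I' W 2) (π : W → V) (pt : W → ℝ)
    (τ : Form I' W 1) : Prop where
  smooth_proj : ContMDiff I' I ∞ π
  smooth_momentum : ContMDiff I' 𝓘(ℝ, ℝ) ∞ pt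
  smooth_angle : τ.SmoothOn univ
  closed : τ.d = 0
  form : ∀ x (v w : TangentSpace I' x), σ' x ![v, w] =
    σ (π x) ![mfderiv I' I π x v, mfderiv I' I π x w] +
      differential pt x v * τ x ![w] - τ x ![v] * differential pt x w
  injective : ∀ x (v : TangentSpace I' x), mfderiv I' I π x v = 0 → differential pt x v = 0 →
    τ x ![v] = 0 → v = 0
  surjective : ∀ x (a : TangentSpace I (π x)) (s t : ℝ), ∃ v : TangentSpace I' x,
    mfderiv I' I π x v = a ∧ differential pt x v = s ∧ τ x ![v] = t

/-- The convex suspension of a Hamiltonian. -/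
def suspension (H : V → ℝ) (π : W → V) (pt : W → ℝ) (w : W) : ℝ := H (π w) + pt w ^ 2 / 2

theorem differential_comp {h : ℝ → ℝ} {pt : W → ℝ} {x : W} (hh : DifferentiableAt ℝ h (pt x))
    (hpt : MDifferentiableAt I' 𝓘(ℝ, ℝ) pt x) (v : TangentSpace I' x) :
    differential (I := I') (fun w => h (pt w)) x v = deriv h (pt x) * differential pt x v := by
  have := mfderiv_comp x hh.mdifferentiableAt hpt
  rw [mfderiv_eq_fderiv] at this
  refine (DFunLike.congr_fun this v).trans ?_
  exact (fderiv_eq_smul_deriv (f := h) (x := pt x) (differential pt x v)).trans (mul_comm _ _)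

theorem differential_suspension {H : V → ℝ} {π : W → V} {pt : W → ℝ} {x : W}
    (hH : MDifferentiableAt I 𝓘(ℝ, ℝ) H (π x)) (hπ : MDifferentiableAt I' I π x)
    (hpt : MDifferentiableAt I' 𝓘(ℝ, ℝ) pt x) (v : TangentSpace I' x) :
    differential (suspension H π pt) x v =
      differential H (π x) (mfderiv I' I π x v) + pt x * differential pt x v := by
  have hsq : DifferentiableAt ℝ (fun s : ℝ => s ^ 2 / 2) (pt x) := by fun_prop
  have h1 : MDifferentiableAt I' 𝓘(ℝ, ℝ) (fun w => pt w ^ 2 / 2) x :=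
    hsq.mdifferentiableAt.comp x hpt
  have h2 : mfderiv I' 𝓘(ℝ, ℝ) (suspension H π pt) x = _ :=
    mfderiv_add (hH.comp x hπ) h1
  refine (DFunLike.congr_fun h2 v).trans ?_
  refine congrArg₂ (· + ·) (DFunLike.congr_fun (mfderiv_comp x hH hπ) v) ?_
  refine (differential_comp (h := fun s : ℝ => s ^ 2 / 2) hsq hpt v).trans ?_
  congr 1
  simp

/-- The characteristic line is that of `X_H + p_t ∂_t`. Noncriticality of `H` matters only where
`p_t = 0`; elsewhere `p_t dp_t` makes the level regular. The factor is nonzero because the frame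
kills no nonzero vector. -/
theorem IsSuspension.exists_eq_smul_hamVF [FiniteDimensional ℝ E] {σ : Form I V 2}
    {σ' : Form I' W 2} {π : W → V} {pt : W → ℝ} {τ : Form I' W 1} (hs : IsSuspension σ σ' π pt τ)
    (hσ : ∀ x, ∀ v : TangentSpace I x, (∀ w : TangentSpace I x, σ x ![v, w] = 0) → v = 0)
    {H : V → ℝ} (hH : ContMDiff I 𝓘(ℝ, ℝ) ∞ H) {x : W}
    (hx : pt x = 0 → (differential H (π x) : TangentSpace I (π x) →L[ℝ] ℝ) ≠ 0)
    {v : TangentSpace I' x} (hv : IsCharacteristic σ' (suspension H π pt) x v) (hv0 : v ≠ 0) :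
    ∃ c : ℝ, c ≠ 0 ∧ mfderiv I' I π x v = c • hamVF σ H (π x) ∧ differential pt x v = 0 ∧
      τ x ![v] = c * pt x := by
  have hd := differential_suspension (I' := I') ((hH (π x)).mdifferentiableAt (by simp))
    ((hs.smooth_proj x).mdifferentiableAt (by simp))
    ((hs.smooth_momentum x).mdifferentiableAt (by simp))
  obtain ⟨k, h1, h2, h3⟩ := exists_eq_smul_of_characteristic (bilin (σ (π x))) (hσ (π x))
    (hamVF σ H (π x)) (differential H (π x) : TangentSpace I (π x) →L[ℝ] ℝ).toLinearMap
    (hamVF_spec σ H (π x) (hσ (π x))) (pt x)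
    (fun h0 h => hx h0 (ContinuousLinearMap.coe_injective h))
    (mfderiv I' I π x : TangentSpace I' x →L[ℝ] TangentSpace I (π x)).toLinearMap
    (fun u => differential pt x u) (fun u => τ x ![u]) (hs.surjective x) v
    ((hd v).symm.trans hv.1) (fun u hu => (hs.form x v u).symm.trans (hv.2 u ((hd u).trans hu)))
  refine ⟨k, ?_, h1, h2, h3⟩
  rintro rfl
  refine hv0 (hs.injective x v (h1.trans (zero_smul _ _)) h2 (h3.trans (zero_mul _)))

end Suspension

/-! ### Regularity of the level and the stabilising form. -/

section Stabilization

variable {E : Type*} [NormedAddCommGroup E] [NormedSpace ℝ E]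
  {B : Type*} [TopologicalSpace B] {I : ModelWithCorners ℝ E B}
  {V : Type*} [TopologicalSpace V] [ChartedSpace B V]
  {E' : Type*} [NormedAddCommGroup E'] [NormedSpace ℝ E']
  {B' : Type*} [TopologicalSpace B'] {I' : ModelWithCorners ℝ E' B'}
  {W : Type*} [TopologicalSpace W] [ChartedSpace B' W]
  {σ : Form I V 2} {σ' : Form I' W 2} {π : W → V} {pt : W → ℝ} {τ : Form I' W 1}
  {H : V → ℝ} {k δ : ℝ} {α : Form I V 1}

theorem IsSuspension.contMDiffAt_comp (hs : IsSuspension σ σ' π pt τ) {f : ℝ → ℝ}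
    (hf : ContDiff ℝ ∞ f) (x : W) : ContMDiffAt I' 𝓘(ℝ, ℝ) ∞ (fun w => f (pt w)) x :=
  hf.contMDiff.contMDiffAt.comp x (hs.smooth_momentum x)

/-- Off the support of `f` the uncontrolled values of `α` drop out; this is the extension by zero.
-/
theorem suspensionForm_eventuallyEq (hpt : Continuous pt) {f g : ℝ → ℝ} {x : W}
    (hx : pt x ∉ tsupport f) :
    ∀ᶠ w in 𝓝 x, (fun w => g (pt w) • τ w : Form I' W 1) w = suspensionForm f g pt π α τ w := by
  have : ∀ᶠ w in 𝓝 x, pt w ∈ (tsupport f)ᶜ :=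
    hpt.continuousAt.eventually ((isClosed_tsupport f).isOpen_compl.mem_nhds hx)
  filter_upwards [this] with w hw
  rw [suspensionForm, image_eq_zero_of_notMem_tsupport hw, zero_smul, zero_add]

section Regularity

variable [FiniteDimensional ℝ E]

/-- At a critical point `X_H = 0`, so `α(X_H)` could not be positive. -/
theorem IsAdapted.differential_ne_zero (hα : IsAdapted σ H k δ α)
    (hσ : ∀ x, ∀ v : TangentSpace I x, (∀ w : TangentSpace I x, σ x ![v, w] = 0) → v = 0)
    {x : V} (hx : H x ∈ Ioo (k - δ) (k + δ)) :
    (differential H x : TangentSpace I x →L[ℝ] ℝ) ≠ 0 := by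
  intro h
  obtain ⟨c, hc, hc'⟩ := hα.constant _ hx
  have h0 : hamVF σ H x = 0 := hσ x _ fun w => by
    rw [hamVF_spec σ H x (hσ x), h]; simp
  have := hc' x rfl
  have hz := alternating_one_smul (α x) 0 (hamVF σ H x)
  rw [zero_smul, zero_mul] at hz
  rw [h0, hz] at this
  exact hc.ne this

/-- A lift of `∂_{p_t}` shows that a critical point has `p_t = 0`; it then lies over `H⁻¹(k)`, where
`H` is regular. -/
theorem IsSuspension.differential_ne_zero (hs : IsSuspension σ σ' π pt τ)
    (hσ : ∀ x, ∀ v : TangentSpace I x, (∀ w : TangentSpace I x, σ x ![v, w] = 0) → v = 0)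
    (hH : ContMDiff I 𝓘(ℝ, ℝ) ∞ H) (hδ : 0 < δ) (hα : IsAdapted σ H k δ α) {x : W}
    (hx : suspension H π pt x = k) :
    (differential (suspension H π pt) x : TangentSpace I' x →L[ℝ] ℝ) ≠ 0 := by
  intro h
  have hd := differential_suspension (I' := I') ((hH (π x)).mdifferentiableAt (by simp))
    ((hs.smooth_proj x).mdifferentiableAt (by simp))
    ((hs.smooth_momentum x).mdifferentiableAt (by simp))
  have h' : ∀ (a : TangentSpace I (π x)) (s : ℝ), differential H (π x) a + pt x * s = 0 := by
    intro a s
    obtain ⟨v, h1, h2, -⟩ := hs.surjective x a s 0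
    have := hd v
    rw [h1, h2, h] at this
    exact this.symm
  have hp : pt x = 0 := by simpa using h' 0 1
  refine hα.differential_ne_zero hσ (x := π x) ?_ ?_
  · have : H (π x) = k := by simpa [suspension, hp] using hx
    rw [this]; constructor <;> linarith
  · ext a
    simpa using h' a 0

theorem IsSuspension.stabilizes_angle (hs : IsSuspension σ σ' π pt τ)
    (hσ : ∀ x, ∀ v : TangentSpace I x, (∀ w : TangentSpace I x, σ x ![v, w] = 0) → v = 0)
    (hH : ContMDiff I 𝓘(ℝ, ℝ) ∞ H) (hne : ¬ (H ⁻¹' {k}).Nonempty) :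
    Stabilizes σ' (suspension H π pt) k τ := by
  refine ⟨⟨univ, isOpen_univ, subset_univ _, hs.smooth_angle⟩, fun x hx v hv hv0 => ?_⟩
  have hp : pt x ≠ 0 := by
    intro hp
    exact hne ⟨π x, by simpa [suspension, hp] using hx⟩
  obtain ⟨c, hc, -, -, h3⟩ := hs.exists_eq_smul_hamVF hσ hH (fun h => absurd h hp) hv hv0
  refine ⟨h3 ▸ mul_ne_zero hc hp, fun u _ => ?_⟩
  rw [hs.closed]
  rfl

end Regularity

variable [I'.Boundaryless] [IsManifold I' ∞ W]

theorem IsSuspension.smoothAt_smul_angle (hs : IsSuspension σ σ' π pt τ) {g : ℝ → ℝ}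
    (hg : ContDiff ℝ ∞ g) (x : W) : Form.SmoothAt (I := I') (fun w => g (pt w) • τ w) x :=
  Form.SmoothAt.smul (hs.contMDiffAt_comp hg x) (hs.smooth_angle x trivial)

theorem IsSuspension.d_smul_angle (hs : IsSuspension σ σ' π pt τ) {g : ℝ → ℝ}
    (hg : ContDiff ℝ ∞ g) (x : W) (v u : TangentSpace I' x) :
    Form.d (I := I') (fun w => g (pt w) • τ w) x ![v, u] =
      deriv g (pt x) * differential pt x v * τ x ![u] -
      deriv g (pt x) * differential pt x u * τ x ![v] := by
  have hpt := (hs.smooth_momentum x).mdifferentiableAt (by simp)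
  have hgd : DifferentiableAt ℝ g (pt x) := hg.differentiable (by simp) _
  rw [Form.d_smul_apply (hs.contMDiffAt_comp hg x) (hs.smooth_angle x trivial),
    differential_comp hgd hpt, differential_comp hgd hpt, hs.closed]
  simp

variable [I.Boundaryless] [IsManifold I ∞ V]

theorem IsSuspension.smoothAt_smul_pullback (hs : IsSuspension σ σ' π pt τ) {f : ℝ → ℝ}
    (hf : ContDiff ℝ ∞ f) {x : W} (hx : α.SmoothAt (π x)) :
    Form.SmoothAt (I := I') (fun w => f (pt w) • (Form.pullback π α : Form I' W 1) w) x :=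
  (hx.pullback (hs.smooth_proj x)).smul (hs.contMDiffAt_comp hf x)

theorem IsSuspension.d_smul_pullback (hs : IsSuspension σ σ' π pt τ) {f : ℝ → ℝ}
    (hf : ContDiff ℝ ∞ f) {x : W} (hx : α.SmoothAt (π x)) (v u : TangentSpace I' x) :
    Form.d (I := I') (fun w => f (pt w) • (Form.pullback π α : Form I' W 1) w) x ![v, u] =
      deriv f (pt x) * differential pt x v * α (π x) ![mfderiv I' I π x u] -
      deriv f (pt x) * differential pt x u * α (π x) ![mfderiv I' I π x v] +
      f (pt x) * α.d (π x) ![mfderiv I' I π x v, mfderiv I' I π x u] := by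
  have hpt := (hs.smooth_momentum x).mdifferentiableAt (by simp)
  have hfd : DifferentiableAt ℝ f (pt x) := hf.differentiable (by simp) _
  rw [Form.d_smul_apply (hs.contMDiffAt_comp hf x) (hx.pullback (hs.smooth_proj x)),
    differential_comp hfd hpt, differential_comp hfd hpt, Form.d_pullback hx (hs.smooth_proj x)]
  rw [Form.pullback_apply_one, Form.pullback_apply_one, Form.pullback_apply_two]

variable [FiniteDimensional ℝ E]

/-- The hypotheses `hfg` and `hpos` are exactly `dθ(v, ·) = 0` and `θ(v) ≠ 0` for `v` over `c X_H`
with `dt(v) = c p_t`, expressed in `s = p_t`. -/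
theorem IsSuspension.stabilizes (hs : IsSuspension σ σ' π pt τ)
    (hσ : ∀ x, ∀ v : TangentSpace I x, (∀ w : TangentSpace I x, σ x ![v, w] = 0) → v = 0)
    (hH : ContMDiff I 𝓘(ℝ, ℝ) ∞ H) (hα : IsAdapted σ H k δ α) {ε : ℝ} (hε : 0 < ε)
    (hεδ : ε < √(2 * δ)) {f g r : ℝ → ℝ} (hf : ContDiff ℝ ∞ f) (hfs : tsupport f ⊆ Ioo (-ε) ε)
    (hg : ContDiff ℝ ∞ g)
    (hr : ∀ s ∈ Ioo (-ε) ε, ∀ x, H x = k - s ^ 2 / 2 → α x ![hamVF σ H x] = r s)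
    (hfg : ∀ s, s * deriv g s = -(r s * deriv f s))
    (hpos : ∀ s, f s * r s + g s * s ≠ 0) :
    Stabilizes σ' (suspension H π pt) k (suspensionForm f g pt π α τ) := by
  have hδ : 0 < δ := by
    have := hε.trans hεδ
    rw [Real.sqrt_pos] at this
    linarith
  -- The bound `ε < √(2δ)` keeps the energy `H = k - p_t² / 2` in the range where `α` is controlled.
  have hsq : ∀ s ∈ Ioo (-ε) ε, s ^ 2 / 2 < δ := by
    intro s hs
    have h1 : s ^ 2 < ε ^ 2 := sq_lt_sq' hs.1 hs.2
    have h2 : ε ^ 2 < 2 * δ := (Real.lt_sqrt hε.le).1 hεδ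
    linarith
  have hmem : ∀ x, suspension H π pt x = k → pt x ∈ Ioo (-ε) ε →
      H (π x) = k - pt x ^ 2 / 2 ∧ H (π x) ∈ Ioo (k - δ) (k + δ) := by
    intro x hx hp
    have h1 : H (π x) = k - pt x ^ 2 / 2 := by rw [← hx, suspension]; ring
    refine ⟨h1, ?_, ?_⟩
    · linarith [hsq _ hp]
    · linarith [sq_nonneg (pt x)]
  have hHc : Continuous fun w => H (π w) := hH.continuous.comp hs.smooth_proj.continuous
  have hptc : Continuous pt := hs.smooth_momentum.continuous
  refine ⟨⟨{w | H (π w) ∈ Ioo (k - δ) (k + δ)} ∪ {w | pt w ∈ (tsupport f)ᶜ},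
    (isOpen_Ioo.preimage hHc).union ((isClosed_tsupport f).isOpen_compl.preimage hptc),
    ?_, ?_⟩, ?_⟩
  · intro x hx
    by_cases hp : pt x ∈ tsupport f
    · exact Or.inl (hmem x hx (hfs hp)).2
    · exact Or.inr hp
  · rintro x (hx | hx)
    · exact (hs.smoothAt_smul_pullback hf (hα.smooth _ hx)).add (hs.smoothAt_smul_angle hg x)
    · exact (hs.smoothAt_smul_angle hg x).congr (suspensionForm_eventuallyEq hptc hx)
  intro x hx v hv hv0
  obtain ⟨c, hc, h1, h2, h3⟩ := hs.exists_eq_smul_hamVF hσ hH (x := x) (fun hp => by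
    have := (hmem x hx (by rw [hp]; constructor <;> linarith)).2
    exact hα.differential_ne_zero hσ this) hv hv0
  -- Outside `(-ε, ε)` the function `r` is unrelated to `α`, so the replacement is legitimate only
  -- under a factor supported in `tsupport f`. It is applied to `f` and to `f'`.
  have hrf : ∀ φ : ℝ, (pt x ∉ tsupport f → φ = 0) →
      φ * α (π x) ![hamVF σ H (π x)] = φ * r (pt x) := by
    intro φ hφ
    by_cases hp : pt x ∈ tsupport f
    · rw [hr _ (hfs hp) _ (hmem x hx (hfs hp)).1]
    · rw [hφ hp, zero_mul, zero_mul]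
  have hdf : pt x ∉ tsupport f → deriv f (pt x) = 0 := fun hp =>
    image_eq_zero_of_notMem_tsupport fun h => hp (tsupport_deriv_subset (𝕜 := ℝ) h)
  constructor
  · have e : suspensionForm f g pt π α τ x ![v] =
        f (pt x) * α (π x) ![mfderiv I' I π x v] + g (pt x) * τ x ![v] := by
      rw [← Form.pullback_apply_one]; rfl
    rw [e, h1, h3, alternating_one_smul]
    have := hrf (f (pt x)) image_eq_zero_of_notMem_tsupport
    have h4 : f (pt x) * (c * α (π x) ![hamVF σ H (π x)]) + g (pt x) * (c * pt x) =
        c * (f (pt x) * r (pt x) + g (pt x) * pt x) := by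
      rw [← this]; ring
    rw [h4]
    exact mul_ne_zero hc (hpos _)
  · intro u _
    have hg0 : deriv g (pt x) * differential pt x u * τ x ![v] =
        -(c * differential pt x u * (deriv f (pt x) * r (pt x))) := by
      rw [h3]
      linear_combination c * differential pt x u * hfg (pt x)
    by_cases hp : pt x ∈ tsupport f
    · have hsm : α.SmoothAt (π x) := hα.smooth _ (hmem x hx (hfs hp)).2
      have hcon : α.d (π x) ![mfderiv I' I π x v, mfderiv I' I π x u] = 0 := by
        rw [h1, ← bilin_apply, map_smul, LinearMap.smul_apply, bilin_apply,
          hα.contraction _ (hmem x hx (hfs hp)).2, smul_zero]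
      have e : (suspensionForm f g pt π α τ).d x = _ :=
        Form.d_add (hs.smoothAt_smul_pullback hf hsm) (hs.smoothAt_smul_angle hg x)
      rw [e]
      refine (congrArg₂ (· + ·) (hs.d_smul_pullback hf hsm v u) (hs.d_smul_angle hg x v u)).trans ?_
      rw [hcon, h2, hg0, h1, alternating_one_smul, ← hrf _ hdf]
      ring
    · rw [← Form.d_congr (suspensionForm_eventuallyEq hptc hp), hs.d_smul_angle hg, hg0, h2,
        hdf hp]
      ring

end Stabilization

/-! ### Smoothness of the level value `r`. -/

section LevelValue

variable {E : Type*} [NormedAddCommGroup E] [NormedSpace ℝ E]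
  {B : Type*} [TopologicalSpace B] {I : ModelWithCorners ℝ E B}
  {V : Type*} [TopologicalSpace V] [ChartedSpace B V]
  {σ : Form I V 2} {H : V → ℝ} {k δ : ℝ} {α : Form I V 1}

theorem IsAdapted.apply_hamVF (hα : IsAdapted σ H k δ α) {ε : ℝ} {r : ℝ → ℝ} (hε : 0 < ε)
    (hεδ : ε < √(2 * δ)) (hr : IsLevelValue σ H k ε α r) {s : ℝ} (hs : s ∈ Ioo (-ε) ε) :
    k - s ^ 2 / 2 ∈ Ioo (k - δ) (k + δ) ∧ 0 < r s ∧
      ∀ x, H x = k - s ^ 2 / 2 → α x ![hamVF σ H x] = r s := by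
  have h1 : s ^ 2 < ε ^ 2 := sq_lt_sq' hs.1 hs.2
  have h2 : ε ^ 2 < 2 * δ := (Real.lt_sqrt hε.le).1 hεδ
  have hm : k - s ^ 2 / 2 ∈ Ioo (k - δ) (k + δ) := by
    constructor <;> nlinarith [sq_nonneg s]
  obtain ⟨c, hc, hc'⟩ := hα.constant _ hm
  obtain ⟨x, hx, hxr⟩ := hr s hs
  have : r s = c := by rw [← hxr, hc' x hx]
  exact ⟨hm, this ▸ hc, fun y hy => by rw [this, hc' y hy]⟩

variable [I.Boundaryless] [IsManifold I ∞ V]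

/-- Restrict `H` to a straight line in the chart, in a direction where `dH ≠ 0`, and invert it by
the inverse function theorem: the line reparametrised by energy is a transversal. In particular all
nearby levels are nonempty. -/
theorem exists_section (hH : ContMDiff I 𝓘(ℝ, ℝ) ∞ H) {x : V}
    (hx : (differential H x : TangentSpace I x →L[ℝ] ℝ) ≠ 0) :
    ∃ γ : ℝ → E, ContDiffAt ℝ ∞ γ (H x) ∧ γ (H x) = extChartAt I x x ∧
      ∀ᶠ c in 𝓝 (H x), H ((extChartAt I x).symm (γ c)) = c := by
  have hHs : ContDiffAt ℝ ∞ (H ∘ (extChartAt I x).symm) (extChartAt I x x) :=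
    Form.contDiffAt_writtenInCharts (x₀' := H x) (mem_extChartAt_source x) (by simp) (hH x)
  obtain ⟨v, hv⟩ : ∃ v : TangentSpace I x, differential H x v ≠ 0 := by
    by_contra! hcon
    exact hx (ContinuousLinearMap.ext hcon)
  have hdh : fderiv ℝ (H ∘ (extChartAt I x).symm) (extChartAt I x x) v =
      differential (I := I) H x v := by
    have h := ((hH x).mdifferentiableAt (by simp)).mfderiv
    rw [I.range_eq_univ, fderivWithin_univ] at h
    exact (DFunLike.congr_fun h v).symm
  let v' : E := v
  let ℓ : ℝ → E := fun t => extChartAt I x x + t • v'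
  have hℓ : ContDiff ℝ ∞ ℓ := by fun_prop
  have hℓ0 : ℓ 0 = extChartAt I x x := by simp [ℓ]
  let ψ : ℝ → ℝ := H ∘ (extChartAt I x).symm ∘ ℓ
  have hψ : ContDiffAt ℝ ∞ ψ 0 := by
    refine ContDiffAt.comp (g := H ∘ (extChartAt I x).symm) 0 ?_ hℓ.contDiffAt
    rwa [hℓ0]
  have hψd : HasDerivAt ψ (differential H x v) 0 := by
    have h1 : HasDerivAt ℓ v' 0 := by
      have := ((hasDerivAt_id (0 : ℝ)).smul_const v').const_add (extChartAt I x x)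
      rwa [one_smul] at this
    have h2 : HasFDerivAt (H ∘ (extChartAt I x).symm)
        (fderiv ℝ (H ∘ (extChartAt I x).symm) (extChartAt I x x)) (ℓ 0) := by
      rw [hℓ0]; exact (hHs.differentiableAt (by simp)).hasFDerivAt
    rw [← hdh]
    exact h2.comp_hasDerivAt 0 h1
  have hψf : HasFDerivAt ψ
      (ContinuousLinearEquiv.unitsEquivAut ℝ (Units.mk0 _ hv) : ℝ →L[ℝ] ℝ) 0 := by
    have := hψd.hasFDerivAt
    convert! this using 1
  have hψ0 : ψ 0 = H x := by
    simp [ψ, hℓ0]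
  have hg := hψ.to_localInverse hψf (by simp)
  have hg0 := hψ.localInverse_apply_image hψf (by simp)
  have hge := (hψ.hasStrictFDerivAt' hψf (by simp)).eventually_right_inverse
  rw [hψ0] at hg hg0 hge
  refine ⟨fun c => ℓ (hψ.localInverse hψf (by simp) c), ?_, ?_, hge⟩
  · exact hℓ.contDiffAt.comp _ hg
  · change ℓ _ = _
    rw [hg0, hℓ0]

variable [FiniteDimensional ℝ E]

/-- A nondegenerate 2-form with smooth coefficients gives a smooth identification of covectors
with vectors. -/
theorem contDiffAt_of_bilin_eq {G : Type*} [NormedAddCommGroup G] [NormedSpace ℝ G]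
    {ω₂ : G → E [⋀^Fin 2]→L[ℝ] ℝ} {β : G → E →L[ℝ] ℝ} {X : G → E} {y₀ : G}
    (hω : ContDiffAt ℝ ∞ ω₂ y₀) (hβ : ContDiffAt ℝ ∞ β y₀)
    (hnd : ∀ᶠ y in 𝓝 y₀, ∀ v, (∀ w, ω₂ y ![v, w] = 0) → v = 0)
    (hX : ∀ᶠ y in 𝓝 y₀, ∀ w, ω₂ y ![X y, w] = β y w) : ContDiffAt ℝ ∞ X y₀ := by
  have : CompleteSpace E := FiniteDimensional.complete ℝ E
  let L : (E [⋀^Fin 1]→L[ℝ] ℝ) →L[ℝ] (E →L[ℝ] ℝ) :=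
    (ContinuousAlternatingMap.ofSubsingletonLIE (𝕜 := ℝ) (E := E) (F := ℝ)
      (0 : Fin 1)).symm.toContinuousLinearEquiv
  let b : G → E →L[ℝ] E →L[ℝ] ℝ := fun y =>
    L.comp (ContinuousAlternatingMap.curryLeftLI (𝕜 := ℝ) (E := E) (F := ℝ) (ω₂ y))
  have hb : ∀ y v w, b y v w = ω₂ y ![v, w] := by
    intro y v w
    change ω₂ y _ = ω₂ y _
    congr 1
    funext i
    fin_cases i <;> rfl
  have hbs : ContDiffAt ℝ ∞ b y₀ := by
    refine contDiffAt_const.clm_comp ?_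
    let Λ : (E [⋀^Fin 2]→L[ℝ] ℝ) →L[ℝ] (E →L[ℝ] E [⋀^Fin 1]→L[ℝ] ℝ) :=
      (ContinuousAlternatingMap.curryLeftLI (𝕜 := ℝ) (E := E) (F := ℝ)).toContinuousLinearMap
    have hΛ : ContDiff ℝ ∞ Λ := by fun_prop
    exact hΛ.contDiffAt.comp y₀ hω
  have hinv : ∀ᶠ y in 𝓝 y₀, (b y).IsInvertible := by
    filter_upwards [hnd] with y hy
    have hinj : Function.Injective (b y) := by
      rw [injective_iff_map_eq_zero]
      intro v hv
      exact hy v fun w => by rw [← hb, hv]; rfl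
    have hfin := (finrank_strongDual E).symm
    have hbij : Function.Surjective (b y) :=
      (LinearMap.injective_iff_surjective_of_finrank_eq_finrank (f := (b y).toLinearMap) hfin).1
        hinj
    refine ⟨(LinearEquiv.ofBijective (b y).toLinearMap ⟨hinj, hbij⟩).toContinuousLinearEquiv, ?_⟩
    ext; rfl
  -- Inversion of continuous linear maps is smooth at invertible ones, so solving for `X` preserves
  -- smoothness.
  have hXe : X =ᶠ[𝓝 y₀] fun y => (b y).inverse (β y) := by
    filter_upwards [hinv, hX] with y hy hXy
    symm
    rw [hy.inverse_apply_eq]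
    ext w
    rw [hb, hXy]
  refine ContDiffAt.congr_of_eventuallyEq ?_ hXe
  exact (ContDiffAt.comp y₀ hinv.self_of_nhds.contDiffAt_map_inverse hbs).clm_apply hβ

/-- The function `α(X_H)` is smooth. -/
theorem contDiffAt_apply_hamVF
    (hσ : ∀ x, ∀ v : TangentSpace I x, (∀ w : TangentSpace I x, σ x ![v, w] = 0) → v = 0)
    (hH : ContMDiff I 𝓘(ℝ, ℝ) ∞ H) {x : V} (hσs : σ.SmoothAt x) (hα : α.SmoothAt x) :
    ContDiffAt ℝ ∞ (fun y => α ((extChartAt I x).symm y) ![hamVF σ H ((extChartAt I x).symm y)])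
      (extChartAt I x x) := by
  -- This is `X_H` in the chart at `x`, where it solves a linear system with smooth coefficients.
  let X : E → E := fun y => mfderiv I 𝓘(ℝ, E) (extChartAt I x) ((extChartAt I x).symm y)
    (hamVF σ H ((extChartAt I x).symm y))
  have htar : ∀ᶠ y in 𝓝 (extChartAt I x x), y ∈ (extChartAt I x).target :=
    extChartAt_target_mem_nhds x
  have hinv : ∀ y ∈ (extChartAt I x).target,
      ∀ v : TangentSpace I ((extChartAt I x).symm y),
      (mfderiv 𝓘(ℝ, E) I (extChartAt I x).symm y : E →L[ℝ] E)
        (mfderiv I 𝓘(ℝ, E) (extChartAt I x) ((extChartAt I x).symm y) v) = v := by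
    intro y hy v
    have := mfderiv_symm_mfderiv_extChartAt (I := I) ((extChartAt I x).map_target hy) v
    rwa [(extChartAt I x).right_inv hy] at this
  have happ : ∀ (y v w : E), σ.inChart x y ![v, w] = σ ((extChartAt I x).symm y)
      ![(mfderiv 𝓘(ℝ, E) I (extChartAt I x).symm y : E →L[ℝ] _) v,
        (mfderiv 𝓘(ℝ, E) I (extChartAt I x).symm y : E →L[ℝ] _) w] := by
    intro y v w
    rw [Form.inChart_apply]
    congr 1
    funext i; fin_cases i <;> rfl
  have hHs : ContDiffAt ℝ ∞ (H ∘ (extChartAt I x).symm) (extChartAt I x x) :=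
    Form.contDiffAt_writtenInCharts (x₀' := H x) (mem_extChartAt_source x) (by simp) (hH x)
  have hXs : ContDiffAt ℝ ∞ X (extChartAt I x x) := by
    refine contDiffAt_of_bilin_eq (β := fun y => -fderiv ℝ (H ∘ (extChartAt I x).symm) y) hσs
      (hHs.fderiv_right (m := ∞) (by simp)).neg ?_ ?_
    · filter_upwards [htar] with y hy v hv
      have h0 : (mfderiv 𝓘(ℝ, E) I (extChartAt I x).symm y : E →L[ℝ] _) v = 0 := by
        refine hσ _ _ fun w => ?_
        have := hv (mfderiv I 𝓘(ℝ, E) (extChartAt I x) ((extChartAt I x).symm y) w)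
        refine Eq.trans ?_ ((happ _ _ _).symm.trans this)
        congr 1
        funext i
        fin_cases i
        · rfl
        · exact (hinv y hy w).symm
      have h1 := mfderiv_extChartAt_mfderiv_symm (I := I) hy v
      exact h1.symm.trans ((congrArg _ h0).trans (map_zero _))
    · filter_upwards [htar] with y hy w
      rw [happ]
      have h1 := hamVF_spec σ H _ (hσ ((extChartAt I x).symm y))
        ((mfderiv 𝓘(ℝ, E) I (extChartAt I x).symm y : E →L[ℝ] _) w)
      have h2 := mfderiv_comp y ((hH _).mdifferentiableAt (by simp))
        (mdifferentiableAt_extChartAt_symm (I := I) hy)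
      rw [mfderiv_eq_fderiv] at h2
      refine Eq.trans ?_ (h1.trans (congrArg Neg.neg (DFunLike.congr_fun h2 w).symm))
      congr 1
      funext i
      fin_cases i
      · exact hinv y hy _
      · rfl
  have hA : (fun y => α ((extChartAt I x).symm y) ![hamVF σ H ((extChartAt I x).symm y)])
      =ᶠ[𝓝 (extChartAt I x x)] fun y =>
        (ContinuousAlternatingMap.ofSubsingletonLIE (𝕜 := ℝ) (E := E) (F := ℝ)
          (0 : Fin 1)).symm (α.inChart x y) (X y) := by
    filter_upwards [htar] with y hy
    change _ = α ((extChartAt I x).symm y) _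
    congr 1
    funext i
    fin_cases i
    exact (hinv y hy _).symm
  refine ContDiffAt.congr_of_eventuallyEq ?_ hA
  refine ContDiffAt.clm_apply ?_ hXs
  exact (ContinuousAlternatingMap.ofSubsingletonLIE (𝕜 := ℝ) (E := E) (F := ℝ)
          (0 : Fin 1)).symm.contDiff.contDiffAt.comp _ hα

/-- Near a noncritical point there is a smooth curve transverse to the levels. -/
theorem IsAdapted.contDiffAt_levelValue (hα : IsAdapted σ H k δ α)
    (hσ : ∀ x, ∀ v : TangentSpace I x, (∀ w : TangentSpace I x, σ x ![v, w] = 0) → v = 0)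
    (hσs : σ.SmoothOn univ) (hH : ContMDiff I 𝓘(ℝ, ℝ) ∞ H) {ε : ℝ} {r : ℝ → ℝ} (hε : 0 < ε)
    (hεδ : ε < √(2 * δ)) (hr : IsLevelValue σ H k ε α r) {s : ℝ} (hs : s ∈ Ioo (-ε) ε) :
    ContDiffAt ℝ ∞ r s := by
  obtain ⟨x, hx, -⟩ := hr s hs
  have hm : H x ∈ Ioo (k - δ) (k + δ) := hx ▸ (hα.apply_hamVF hε hεδ hr hs).1
  obtain ⟨γ, hγ, hγx, hγe⟩ := exists_section (I := I) hH (hα.differential_ne_zero hσ hm)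
  rw [hx] at hγ hγx hγe
  have hq : ContDiff ℝ ∞ fun u : ℝ => k - u ^ 2 / 2 := by fun_prop
  have hA := contDiffAt_apply_hamVF hσ hH (hσs x trivial) (hα.smooth x hm)
  rw [← hγx] at hA
  -- Near `s`, `r` is `α(X_H)` along the transversal at energy `k - u² / 2`. Only composition with
  -- this map is used, so its degeneracy at `u = 0` is harmless.
  have hcomp := ContDiffAt.comp s (ContDiffAt.comp (k - s ^ 2 / 2) hA hγ) hq.contDiffAt
  refine hcomp.congr_of_eventuallyEq ?_
  have he := (hq.continuous.continuousAt (x := s)).eventually hγe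
  filter_upwards [he, isOpen_Ioo.mem_nhds hs] with u hu hus
  exact ((hα.apply_hamVF hε hεδ hr hus).2.2 _ hu).symm

end LevelValue

/-! ### One-variable analysis of the cut-off `f` and of `g`. -/

section CutoffFunctions

theorem IsCutoff.deriv_eq_zero_of_notMem {ε : ℝ} {f : ℝ → ℝ} (hf : IsCutoff ε f) {u : ℝ}
    (hu : u ∉ Ioo (-ε) ε) : u ∉ tsupport (deriv f) :=
  fun h => hu (hf.support (tsupport_deriv_subset (𝕜 := ℝ) h))

theorem IsCutoff.deriv_nonneg {ε : ℝ} {f : ℝ → ℝ} (hf : IsCutoff ε f) {u : ℝ} (hu : u ≤ 0) :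
    0 ≤ deriv f u := by
  have h : (fun s => f (-s)) = f := funext hf.even
  have h1 := deriv_comp_neg f u
  rw [h] at h1
  rw [h1]
  linarith [hf.deriv_nonpos (-u) (by linarith)]

theorem IsCutoff.deriv_eventuallyEq_zero {ε : ℝ} {f : ℝ → ℝ} (hf : IsCutoff ε f) {u : ℝ}
    (hu : u ∈ Ioo (-(ε / 2)) (ε / 2)) : deriv f =ᶠ[𝓝 u] 0 := by
  have : f =ᶠ[𝓝 u] fun _ => 1 := by
    filter_upwards [isOpen_Ioo.mem_nhds hu] with v hv using hf.eq_one v hv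
  refine this.deriv.trans (Eventually.of_forall fun v => ?_)
  simp

variable {ε : ℝ} {f r : ℝ → ℝ}

/-- The only dangers are `u = 0` and points where `r` is uncontrolled; near both, `f'` vanishes
identically. -/
theorem IsCutoff.contDiff_integrand (hε : 0 < ε) (hf : IsCutoff ε f)
    (hr : ∀ s ∈ Ioo (-ε) ε, ContDiffAt ℝ ∞ r s) : ContDiff ℝ ∞ fun u => r u * deriv f u / u := by
  have hdf : ContDiff ℝ ∞ (deriv f) := (contDiff_infty_iff_deriv.1 hf.smooth).2
  rw [contDiff_iff_contDiffAt]
  intro u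
  have hz : deriv f =ᶠ[𝓝 u] 0 → ContDiffAt ℝ ∞ (fun u => r u * deriv f u / u) u := by
    intro h
    refine (contDiffAt_const (c := (0 : ℝ))).congr_of_eventuallyEq ?_
    filter_upwards [h] with v hv
    rw [hv]; simp
  by_cases h1 : u ∈ Ioo (-(ε / 2)) (ε / 2)
  · exact hz (hf.deriv_eventuallyEq_zero h1)
  by_cases h2 : u ∈ Ioo (-ε) ε
  · have hu : u ≠ 0 := by
      rintro rfl
      exact h1 ⟨by linarith, by linarith⟩
    exact ((hr u h2).mul hdf.contDiffAt).div contDiffAt_id hu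
  · exact hz (notMem_tsupport_iff_eventuallyEq.1 (hf.deriv_eq_zero_of_notMem h2))

theorem IsCutoff.hasDerivAt_gFun (hε : 0 < ε) (hf : IsCutoff ε f)
    (hr : ∀ s ∈ Ioo (-ε) ε, ContDiffAt ℝ ∞ r s) (s : ℝ) :
    HasDerivAt (gFun r f) (-(r s * deriv f s / s)) s := by
  have hc := (hf.contDiff_integrand hε hr).continuous
  exact (intervalIntegral.integral_hasDerivAt_right (hc.intervalIntegrable _ _)
    (hc.stronglyMeasurableAtFilter _ _) hc.continuousAt).neg

theorem IsCutoff.contDiff_gFun (hε : 0 < ε) (hf : IsCutoff ε f)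
    (hr : ∀ s ∈ Ioo (-ε) ε, ContDiffAt ℝ ∞ r s) : ContDiff ℝ ∞ (gFun r f) := by
  have hd := hf.hasDerivAt_gFun hε hr
  rw [contDiff_infty_iff_deriv]
  refine ⟨fun s => (hd s).differentiableAt, ?_⟩
  rw [show deriv (gFun r f) = fun s => -(r s * deriv f s / s) from funext fun s => (hd s).deriv]
  exact (hf.contDiff_integrand hε hr).neg

theorem IsCutoff.mul_deriv_gFun (hε : 0 < ε) (hf : IsCutoff ε f)
    (hr : ∀ s ∈ Ioo (-ε) ε, ContDiffAt ℝ ∞ r s) (s : ℝ) :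
    s * deriv (gFun r f) s = -(r s * deriv f s) := by
  rw [(hf.hasDerivAt_gFun hε hr s).deriv]
  by_cases hs : s = 0
  · have : deriv f s = 0 :=
      (hf.deriv_eventuallyEq_zero (u := s) (by rw [hs]; constructor <;> linarith)).self_of_nhds
    rw [this]; simp
  · field_simp

theorem IsCutoff.integrand_nonpos (hf : IsCutoff ε f) (hpos : ∀ s ∈ Ioo (-ε) ε, 0 < r s) (u : ℝ) :
    r u * deriv f u / u ≤ 0 := by
  by_cases hu : u ∈ Ioo (-ε) ε
  · rcases le_total 0 u with h | h
    · exact div_nonpos_of_nonpos_of_nonneg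
        (mul_nonpos_of_nonneg_of_nonpos (hpos u hu).le (hf.deriv_nonpos u h)) h
    · exact div_nonpos_of_nonneg_of_nonpos (mul_nonneg (hpos u hu).le (hf.deriv_nonneg h)) h
  · rw [image_eq_zero_of_notMem_tsupport (hf.deriv_eq_zero_of_notMem hu)]
    simp

/-- Both summands are nonnegative: `g` is nondecreasing and vanishes at `0`. The first is positive
unless `f s = 0`, and in that case the second must be shown nonzero. -/
theorem IsCutoff.add_mul_gFun_ne_zero (hε : 0 < ε) (hf : IsCutoff ε f)
    (hr : ∀ s ∈ Ioo (-ε) ε, ContDiffAt ℝ ∞ r s) (hpos : ∀ s ∈ Ioo (-ε) ε, 0 < r s) (s : ℝ) :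
    f s * r s + gFun r f s * s ≠ 0 := by
  have hd := hf.hasDerivAt_gFun hε hr
  have hmono : Monotone (gFun r f) := by
    refine monotone_of_deriv_nonneg (fun s => (hd s).differentiableAt) fun u => ?_
    rw [(hd u).deriv]
    linarith [hf.integrand_nonpos hpos u]
  have h0 : gFun r f 0 = 0 := by simp [gFun]
  have hgs : 0 ≤ gFun r f s * s := by
    rcases le_total 0 s with h | h
    · exact mul_nonneg (h0 ▸ hmono h) h
    · exact mul_nonneg_of_nonpos_of_nonpos (h0 ▸ hmono h) h
  have hf0 : f 0 = 1 := hf.eq_one 0 ⟨by linarith, by linarith⟩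
  rcases (hf.nonneg s).eq_or_lt with hfs | hfs
  · have hs0 : s ≠ 0 := by
      rintro rfl
      linarith
    rw [← hfs, zero_mul, zero_add]
    refine mul_ne_zero (fun hg => ?_) hs0
    have hfd : Differentiable ℝ f := hf.smooth.differentiable (by simp)
    -- Monotonicity makes `g` vanish throughout `[a, b]`, while the mean value theorem finds a point
    -- there with `f' ≠ 0`. This contradicts `u g' = -r f'` with `r > 0`.
    have key : ∀ a b : ℝ, a < b → f a ≠ f b → gFun r f a = 0 → gFun r f b = 0 → False := by
      intro a b hab hne ha hb
      obtain ⟨u, hu, hu'⟩ := exists_deriv_eq_slope f hab hfd.continuous.continuousOn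
        hfd.differentiableOn
      have hu0 : deriv f u ≠ 0 := by
        rw [hu']
        exact div_ne_zero (sub_ne_zero.2 hne.symm) (by linarith)
      have hgz : gFun r f =ᶠ[𝓝 u] fun _ => 0 := by
        filter_upwards [isOpen_Ioo.mem_nhds hu] with v hv
        exact le_antisymm (hb ▸ hmono hv.2.le) (ha ▸ hmono hv.1.le)
      have hgd : deriv (gFun r f) u = 0 := by rw [hgz.deriv_eq]; simp
      have := hf.mul_deriv_gFun hε hr u
      rw [hgd, mul_zero, eq_comm, neg_eq_zero] at this
      have huI : u ∈ Ioo (-ε) ε := by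
        by_contra hn
        exact hu0 (image_eq_zero_of_notMem_tsupport (hf.deriv_eq_zero_of_notMem hn))
      exact mul_ne_zero (hpos u huI).ne' hu0 this
    rcases lt_or_gt_of_ne hs0 with h | h
    · exact key s 0 h (by rw [hf0, ← hfs]; norm_num) hg h0
    · exact key 0 s h (by rw [hf0, ← hfs]; norm_num) h0 hg
  · have hsI : s ∈ Ioo (-ε) ε := by
      by_contra hn
      exact hfs.ne' (image_eq_zero_of_notMem_tsupport fun h => hn (hf.support h))
    have := mul_pos hfs (hpos s hsI)
    positivity

theorem exists_isCutoff (hε : 0 < ε) : ∃ f, IsCutoff ε f := by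
  -- The quadratic in `s` equal to `1` at `|s| = ε/2` and to `0` at `|s| = 3ε/4`, so that the smooth
  -- transition is constant inside and outside these radii.
  let q : ℝ → ℝ := fun s => (9 * ε ^ 2 - 16 * s ^ 2) / (5 * ε ^ 2)
  have hq : ContDiff ℝ ∞ q := by fun_prop
  have hz : ∀ s, s ∉ Icc (-(3 * ε / 4)) (3 * ε / 4) → Real.smoothTransition (q s) = 0 := by
    intro s hs
    apply Real.smoothTransition.zero_of_nonpos
    apply div_nonpos_of_nonpos_of_nonneg _ (by positivity)
    have : 3 * ε / 4 < |s| := by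
      by_contra! h
      exact hs (abs_le.1 h)
    have h2 := sq_abs s
    nlinarith
  have hsm : ContDiff ℝ ∞ fun s => Real.smoothTransition (q s) :=
    Real.smoothTransition.contDiff.comp hq
  have hdS : Differentiable ℝ Real.smoothTransition :=
    (Real.smoothTransition.contDiff (n := 1)).differentiable (by simp)
  refine ⟨fun s => Real.smoothTransition (q s), hsm, fun s => by simp [q], ?_,
    fun s => Real.smoothTransition.nonneg _, ?_, ?_⟩
  · refine (closure_minimal (fun s hs => ?_) isClosed_Icc).trans
      (Icc_subset_Ioo (by linarith) (by linarith) : Icc (-(3 * ε / 4)) (3 * ε / 4) ⊆ Ioo (-ε) ε)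
    by_contra h
    exact hs (hz s h)
  · intro s hs
    apply Real.smoothTransition.one_of_one_le
    rw [le_div_iff₀ (by positivity)]
    nlinarith [hs.1, hs.2]
  · intro s hs
    have hqd : HasDerivAt q (-(32 * s) / (5 * ε ^ 2)) s := by
      have := (((hasDerivAt_pow 2 s).const_mul 16).const_sub (9 * ε ^ 2)).div_const (5 * ε ^ 2)
      convert! this using 1
      ring
    have := (hdS (q s)).hasDerivAt.comp s hqd
    rw [show (fun s => Real.smoothTransition (q s)) = Real.smoothTransition ∘ q from rfl,
      this.deriv]
    refine mul_nonpos_of_nonneg_of_nonpos Real.smoothTransition.monotone.deriv_nonneg ?_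
    exact div_nonpos_of_nonpos_of_nonneg (by linarith) (by positivity)

end CutoffFunctions

/-! ### The theorem for abstract suspensions. -/

section Conclusion

variable {E : Type*} [NormedAddCommGroup E] [NormedSpace ℝ E] [FiniteDimensional ℝ E]
  {B : Type*} [TopologicalSpace B] {I : ModelWithCorners ℝ E B} [I.Boundaryless]
  {V : Type*} [TopologicalSpace V] [ChartedSpace B V] [IsManifold I ∞ V]
  {E' : Type*} [NormedAddCommGroup E'] [NormedSpace ℝ E']
  {B' : Type*} [TopologicalSpace B'] {I' : ModelWithCorners ℝ E' B'} [I'.Boundaryless]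
  {W : Type*} [TopologicalSpace W] [ChartedSpace B' W] [IsManifold I' ∞ W]
  {σ : Form I V 2} {σ' : Form I' W 2} {π : W → V} {pt : W → ℝ} {τ : Form I' W 1}
  {H : V → ℝ} {k δ : ℝ} {α : Form I V 1}

theorem IsAdapted.exists_levelValue (hα : IsAdapted σ H k δ α)
    (hσ : ∀ x, ∀ v : TangentSpace I x, (∀ w : TangentSpace I x, σ x ![v, w] = 0) → v = 0)
    (hH : ContMDiff I 𝓘(ℝ, ℝ) ∞ H) (hδ : 0 < δ) (hne : (H ⁻¹' {k}).Nonempty) :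
    ∃ ε : ℝ, 0 < ε ∧ ε < √(2 * δ) ∧ ∃ f r : ℝ → ℝ, IsCutoff ε f ∧ IsLevelValue σ H k ε α r := by
  obtain ⟨x, hx⟩ := hne
  have hx : H x = k := hx
  obtain ⟨γ, -, -, hγ⟩ := exists_section (I := I) hH (hα.differential_ne_zero hσ
    (x := x) (by rw [hx]; constructor <;> linarith))
  rw [hx] at hγ
  obtain ⟨η, hη, hηγ⟩ := Metric.eventually_nhds_iff.1 hγ
  have hsδ : 0 < √(2 * δ) := Real.sqrt_pos.2 (by linarith)
  -- With `ε ≤ 1` and `ε ≤ η`, `|s| < ε` implies `s² / 2 < η`, so the transversal reaches the level;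
  -- halving the root makes the bound strict.
  let ε := min (√(2 * δ) / 2) (min 1 η)
  have hε : 0 < ε := lt_min (by linarith) (lt_min one_pos hη)
  have hε1 : ε ≤ 1 := (min_le_right _ _).trans (min_le_left _ _)
  have hεη : ε ≤ η := (min_le_right _ _).trans (min_le_right _ _)
  obtain ⟨f, hf⟩ := exists_isCutoff hε
  have hlev : ∀ s ∈ Ioo (-ε) ε, ∃ y, H y = k - s ^ 2 / 2 := by
    intro s hs
    have : dist (k - s ^ 2 / 2) k < η := by
      rw [Real.dist_eq, show k - s ^ 2 / 2 - k = -(s ^ 2 / 2) by ring, abs_neg,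
        abs_of_nonneg (by positivity)]
      nlinarith [hs.1, hs.2]
    exact ⟨_, hηγ this⟩
  choose y hy using hlev
  refine ⟨ε, hε, (min_le_left _ _).trans_lt (by linarith), f, fun s => if hs : s ∈ Ioo (-ε) ε then
    α (y s hs) ![hamVF σ H (y s hs)] else 0, hf, fun s hs => ⟨y s hs, hy s hs, ?_⟩⟩
  beta_reduce
  rw [dif_pos hs]

theorem IsSuspension.stabilizes_suspensionForm (hs : IsSuspension σ σ' π pt τ)
    (hσ : ∀ x, ∀ v : TangentSpace I x, (∀ w : TangentSpace I x, σ x ![v, w] = 0) → v = 0)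
    (hσs : σ.SmoothOn univ) (hH : ContMDiff I 𝓘(ℝ, ℝ) ∞ H) (hα : IsAdapted σ H k δ α) {ε : ℝ}
    (hε : 0 < ε) (hεδ : ε < √(2 * δ)) {f r : ℝ → ℝ} (hf : IsCutoff ε f)
    (hr : IsLevelValue σ H k ε α r) :
    ContDiff ℝ ∞ (gFun r f) ∧
      Stabilizes σ' (suspension H π pt) k (suspensionForm f (gFun r f) pt π α τ) := by
  have hrs : ∀ s ∈ Ioo (-ε) ε, ContDiffAt ℝ ∞ r s := fun s h =>
    hα.contDiffAt_levelValue hσ hσs hH hε hεδ hr h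
  have hg := hf.contDiff_gFun hε hrs
  exact ⟨hg, hs.stabilizes hσ hH hα hε hεδ hf.smooth hf.support hg
    (fun s h => (hα.apply_hamVF hε hεδ hr h).2.2) (hf.mul_deriv_gFun hε hrs)
    (hf.add_mul_gFun_ne_zero hε hrs fun s h => (hα.apply_hamVF hε hεδ hr h).2.1)⟩

theorem IsSuspension.main (hs : IsSuspension σ σ' π pt τ)
    (hσ : ∀ x, ∀ v : TangentSpace I x, (∀ w : TangentSpace I x, σ x ![v, w] = 0) → v = 0)
    (hσs : σ.SmoothOn univ) (hH : ContMDiff I 𝓘(ℝ, ℝ) ∞ H) (hδ : 0 < δ)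
    (hα : IsAdapted σ H k δ α) :
    IsStableLevel σ' (suspension H π pt) k ∧
      ((H ⁻¹' {k}).Nonempty → ∃ ε : ℝ, 0 < ε ∧ ε < √(2 * δ) ∧ ∃ f r : ℝ → ℝ,
        IsCutoff ε f ∧ IsLevelValue σ H k ε α r) ∧
      ∀ ε : ℝ, 0 < ε → ε < √(2 * δ) → ∀ f r : ℝ → ℝ, IsCutoff ε f → IsLevelValue σ H k ε α r →
        ContDiff ℝ ∞ (gFun r f) ∧
          Stabilizes σ' (suspension H π pt) k (suspensionForm f (gFun r f) pt π α τ) := by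
  refine ⟨⟨fun x hx => hs.differential_ne_zero hσ hH hδ hα hx, ?_⟩,
    hα.exists_levelValue hσ hH hδ, fun ε hε hεδ f r hf hr =>
      hs.stabilizes_suspensionForm hσ hσs hH hα hε hεδ hf hr⟩
  by_cases hne : (H ⁻¹' {k}).Nonempty
  · obtain ⟨ε, hε, hεδ, f, r, hf, hr⟩ := hα.exists_levelValue hσ hH hδ hne
    exact ⟨_, (hs.stabilizes_suspensionForm hσ hσs hH hα hε hεδ hf hr).2⟩
  · exact ⟨τ, hs.stabilizes_angle hσ hH hne⟩

end Conclusion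

/-! ### The Liouville form and the canonical form in bundle charts. -/

section CotangentBundle

variable {E : Type*} [NormedAddCommGroup E] [NormedSpace ℝ E]
  {B : Type*} [TopologicalSpace B] {I : ModelWithCorners ℝ E B}
  {M : Type*} [TopologicalSpace M] [ChartedSpace B M] [IsManifold I ∞ M]

/-- The fibre coordinate of a covector in the chart around `x₀`. -/
def CotangentBundle.fiberCoord (x₀ : M) (Q : CotangentBundle I M) : E →L[ℝ] ℝ :=
  (trivializationAt (E →L[ℝ] ℝ)
    (fun x : M => TangentSpace I x →L[ℝ] Bundle.Trivial M ℝ x) x₀ Q).2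

theorem CotangentBundle.extChartAt_eq (P Q : CotangentBundle I M) :
    extChartAt (cotangentModel I) P Q = (extChartAt I P.proj Q.proj, Q.fiberCoord P.proj) := by
  rw [FiberBundle.extChartAt]
  rfl

theorem CotangentBundle.mem_extChartAt_source {P Q : CotangentBundle I M}
    (h : Q ∈ (extChartAt (cotangentModel I) P).source) :
    Q.proj ∈ (extChartAt I P.proj).source := by
  rw [FiberBundle.extChartAt, PartialEquiv.trans_source] at h
  exact h.2.1

theorem CotangentBundle.contMDiff_proj :
    ContMDiff (cotangentModel I) I ∞ (fun Q : CotangentBundle I M => Q.proj) :=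
  Bundle.contMDiff_proj _

theorem liouville_apply (P : CotangentBundle I M) (v : TangentSpace (cotangentModel I) P) :
    liouville I M P ![v] = P.covector
      (mfderiv (cotangentModel I) I (fun Q : CotangentBundle I M => Q.proj) P v) := rfl

variable [I.Boundaryless]

/-- The fibre coordinate is the covector pulled back by the inverse chart: the classical momentum
coordinate. -/
theorem CotangentBundle.fiberCoord_apply {x₀ : M} {Q : CotangentBundle I M}
    (hQ : Q.proj ∈ (extChartAt I x₀).source) (w : E) :
    Q.fiberCoord x₀ w = Q.covector
      ((mfderiv 𝓘(ℝ, E) I (extChartAt I x₀).symm (extChartAt I x₀ Q.proj) : E →L[ℝ] E) w) := by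
  rw [extChartAt_source] at hQ
  have h := TangentBundle.symmL_trivializationAt (I := I) hQ
  rw [I.range_eq_univ, mfderivWithin_univ] at h
  rw [fiberCoord, hom_trivializationAt_apply]
  change ContinuousLinearMap.inCoordinates _ _ _ _ _ _ _ _ _ w = _
  have ht : ((trivializationAt ℝ (Bundle.Trivial M ℝ) x₀).continuousLinearMapAt ℝ Q.proj :
      ℝ →L[ℝ] ℝ) = ContinuousLinearMap.id ℝ ℝ :=
    Bundle.Trivial.continuousLinearMapAt_trivialization ℝ M ℝ Q.proj
  exact (DFunLike.congr_fun ht _).trans (congrArg Q.covector (DFunLike.congr_fun h w))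

/-- The 1-form `p dq` on `E × E^*`. -/
def modelLiouville (E : Type*) [NormedAddCommGroup E] [NormedSpace ℝ E] :
    (E × (E →L[ℝ] ℝ)) →L[ℝ] (E × (E →L[ℝ] ℝ)) [⋀^Fin 1]→L[ℝ] ℝ :=
  (ContinuousAlternatingMap.ofSubsingletonLIE (𝕜 := ℝ) (E := E × (E →L[ℝ] ℝ)) (F := ℝ)
    (0 : Fin 1)).toContinuousLinearEquiv.toContinuousLinearMap.comp
    (((ContinuousLinearMap.compL ℝ (E × (E →L[ℝ] ℝ)) E ℝ).flip
      (ContinuousLinearMap.fst ℝ E (E →L[ℝ] ℝ))).comp (ContinuousLinearMap.snd ℝ E (E →L[ℝ] ℝ)))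

theorem extDeriv_modelLiouville (y v w : E × (E →L[ℝ] ℝ)) :
    extDeriv (modelLiouville E) y ![v, w] = v.2 w.1 - w.2 v.1 := by
  rw [extDeriv_apply (modelLiouville E).differentiableAt, Fin.sum_univ_two]
  have h (u : Fin 1 → E × (E →L[ℝ] ℝ)) (z : E × (E →L[ℝ] ℝ)) :
      fderiv ℝ (fun x => modelLiouville E x u) y z = z.2 (u 0).1 := by
    have : HasFDerivAt (fun x => modelLiouville E x u)
        ((ContinuousAlternatingMap.apply ℝ (E × (E →L[ℝ] ℝ)) ℝ u).comp (modelLiouville E)) y :=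
      ((ContinuousAlternatingMap.apply ℝ (E × (E →L[ℝ] ℝ)) ℝ u).comp
        (modelLiouville E)).hasFDerivAt
    rw [this.fderiv]
    rfl
  rw [h, h]
  simp [Fin.removeNth, sub_eq_add_neg]

/-- In a bundle chart the projection is `(q, p) ↦ q` and the fibre coordinate is `p`, so the
Liouville form is literally `p dq` there. Smoothness and the formula for the canonical form follow
from this constant-coefficient model. -/
theorem liouville_inChart_eventuallyEq (P : CotangentBundle I M) :
    (liouville I M).inChart P =ᶠ[𝓝 (extChartAt (cotangentModel I) P P)] modelLiouville E := by
  have h1 : ∀ᶠ y in 𝓝 (extChartAt (cotangentModel I) P P),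
      y ∈ (extChartAt (cotangentModel I) P).target := extChartAt_target_mem_nhds P
  filter_upwards [h1.eventually_nhds] with y hy
  have hyt := hy.self_of_nhds
  ext v
  set e := extChartAt (cotangentModel I) P with he
  set Q := e.symm y with hQ
  have hQs := CotangentBundle.mem_extChartAt_source (e.map_target hyt)
  have hQy : (extChartAt I P.proj Q.proj, Q.fiberCoord P.proj) = y :=
    (CotangentBundle.extChartAt_eq P Q).symm.trans (e.right_inv hyt)
  have hev : (fun z => (e.symm z).proj) =ᶠ[𝓝 y] fun z => (extChartAt I P.proj).symm z.1 := by
    filter_upwards [hy] with z hz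
    have hzs := CotangentBundle.mem_extChartAt_source (e.map_target hz)
    have := congrArg Prod.fst ((CotangentBundle.extChartAt_eq P (e.symm z)).symm.trans
      (e.right_inv hz))
    rw [← this]
    exact ((extChartAt I P.proj).left_inv hzs).symm
  have hy1 : y.1 = extChartAt I P.proj Q.proj := (congrArg Prod.fst hQy).symm
  have d1 := mfderiv_comp y
    ((CotangentBundle.contMDiff_proj (I := I) (e.symm y)).mdifferentiableAt (by simp))
    (mdifferentiableAt_extChartAt_symm (I := cotangentModel I) hyt)
  have d2 := hev.mfderiv_eq (I := 𝓘(ℝ, E × (E →L[ℝ] ℝ))) (I' := I)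
  have hsy : MDifferentiableAt 𝓘(ℝ, E) I (extChartAt I P.proj).symm y.1 := by
    rw [hy1]
    exact mdifferentiableAt_extChartAt_symm ((extChartAt I P.proj).map_source hQs)
  have d3 := mfderiv_comp (I := 𝓘(ℝ, E × (E →L[ℝ] ℝ))) (I' := 𝓘(ℝ, E)) (I'' := I) y
    (g := (extChartAt I P.proj).symm) (f := fun z : E × (E →L[ℝ] ℝ) => z.1) hsy
    (differentiableAt_fst.mdifferentiableAt)
  rw [mfderiv_eq_fderiv, fderiv_fst] at d3
  change Q.covector (mfderiv (cotangentModel I) I (fun Q : CotangentBundle I M => Q.proj) Q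
    (mfderiv 𝓘(ℝ, E × (E →L[ℝ] ℝ)) (cotangentModel I) e.symm y (v 0))) = y.2 (v 0).1
  have hfib := Q.fiberCoord_apply hQs (v 0).1
  have hy2 : Q.fiberCoord P.proj = y.2 := congrArg Prod.snd hQy
  rw [hy2, ← hy1] at hfib
  rw [hfib]
  refine congrArg Q.covector ?_
  exact (DFunLike.congr_fun d1 (v 0)).symm.trans
    ((DFunLike.congr_fun d2 (v 0)).trans (DFunLike.congr_fun d3 (v 0)))

theorem liouville_smoothAt (P : CotangentBundle I M) : (liouville I M).SmoothAt P :=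
  (modelLiouville E).contDiff.contDiffAt.congr_of_eventuallyEq (liouville_inChart_eventuallyEq P)

theorem canonicalForm_smoothOn : (canonicalForm I M).SmoothOn univ :=
  Form.SmoothOn.d isOpen_univ fun P _ => liouville_smoothAt P

theorem canonicalForm_apply (P : CotangentBundle I M)
    (v w : E × (E →L[ℝ] ℝ)) :
    canonicalForm I M P ![(v : TangentSpace (cotangentModel I) P), w] = v.2 w.1 - w.2 v.1 := by
  refine (Form.d_apply (liouville I M) P _).trans ?_
  rw [(liouville_inChart_eventuallyEq P).extDeriv_eq]
  exact extDeriv_modelLiouville _ v w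

theorem canonicalForm_nondegenerate (P : CotangentBundle I M)
    (v : TangentSpace (cotangentModel I) P)
    (hv : ∀ w : TangentSpace (cotangentModel I) P, canonicalForm I M P ![v, w] = 0) : v = 0 := by
  let v' : E × (E →L[ℝ] ℝ) := v
  have h : ∀ w : E × (E →L[ℝ] ℝ), v'.2 w.1 - w.2 v'.1 = 0 := fun w =>
    (canonicalForm_apply P v' w).symm.trans (hv w)
  have h1 : v'.1 = 0 := by
    by_contra hne
    obtain ⟨φ, hφ⟩ := SeparatingDual.exists_ne_zero (R := ℝ) hne
    exact hφ (by simpa using h (0, φ))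
  have h2 : v'.2 = 0 := by
    ext w
    simpa using h (w, 0)
  exact Prod.ext h1 h2

end CotangentBundle

/-! ### The angular form and the unit vector field on the circle. -/

section Circle

/-- The 1-form `Im (z̄ dz)` on the plane. -/
def planarAngle : Form 𝓘(ℝ, ℂ) ℂ 1 :=
  oneForm fun z => (Complex.imCLM.comp (ContinuousLinearMap.mul ℝ ℂ (starRingEnd ℂ z)))

theorem planarAngle_smoothAt (z : ℂ) : planarAngle.SmoothAt z := by
  let L : ℂ →L[ℝ] ℂ [⋀^Fin 1]→L[ℝ] ℝ :=
    (ContinuousAlternatingMap.ofSubsingletonLIE (𝕜 := ℝ) (E := ℂ) (F := ℝ)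
      (0 : Fin 1)).toContinuousLinearEquiv.toContinuousLinearMap.comp
      ((ContinuousLinearMap.compL ℝ ℂ ℂ ℝ Complex.imCLM).comp
        ((ContinuousLinearMap.mul ℝ ℂ).comp Complex.conjCLE.toContinuousLinearMap))
  refine L.contDiff.contDiffAt.congr_of_eventuallyEq (Eventually.of_forall fun y => ?_)
  ext v
  rw [Form.inChart_apply]
  let D : ℂ →L[ℝ] ℂ := mfderiv 𝓘(ℝ, ℂ) 𝓘(ℝ, ℂ) (extChartAt 𝓘(ℝ, ℂ) z).symm y
  have h : ∀ w : ℂ, D w = w := by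
    intro w
    have : mfderiv 𝓘(ℝ, ℂ) 𝓘(ℝ, ℂ) (id : ℂ → ℂ) y = ContinuousLinearMap.id ℝ _ := mfderiv_id
    exact DFunLike.congr_fun this w
  change (starRingEnd ℂ y * D (v 0)).im = (starRingEnd ℂ y * v 0).im
  rw [h]

theorem contMDiff_circle_coe : ContMDiff (𝓡 1) 𝓘(ℝ, ℂ) ∞ (fun w : Circle => (w : ℂ)) :=
  have : Fact (Module.finrank ℝ ℂ = 1 + 1) := ⟨Complex.finrank_real_complex⟩
  contMDiff_coe_sphere (E := ℂ) (n := 1)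

theorem dt_eq_pullback : dt = (Form.pullback (fun w : Circle => (w : ℂ)) planarAngle :
    Form (𝓡 1) Circle 1) := rfl

theorem dt_smoothAt (z : Circle) : dt.SmoothAt z := by
  rw [dt_eq_pullback]
  exact (planarAngle_smoothAt _).pullback (contMDiff_circle_coe z)

/-- Two vectors in a one-dimensional tangent space are dependent, so every 2-form on the circle
vanishes. -/
theorem d_dt : dt.d = 0 := by
  funext z
  ext v
  let v' : Fin 2 → EuclideanSpace ℝ (Fin 1) := v
  refine AlternatingMap.map_linearDependent (K := ℝ)
    (dt.d z).toAlternatingMap v fun h => ?_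
  have h' : LinearIndependent ℝ v' := h
  have := h'.fintype_card_le_finrank
  simp at this

theorem contMDiff_exp_mul : ContMDiff (𝓘(ℝ, ℝ).prod (𝓡 1)) (𝓡 1) ∞
    (fun p : ℝ × Circle => Circle.exp p.1 * p.2) := by
  have : LieGroup (𝓡 1) ∞ Circle := .of_le (n := ω) le_top
  exact (contMDiff_circleExp.comp contMDiff_fst).mul contMDiff_snd

/-- The field is the image of `(∂/∂s, 0)` at `(0, z)` under the tangent map of the smooth action
`(s, z) ↦ exp(is) z`. -/
theorem contMDiff_ddt : ContMDiff (𝓡 1) (𝓡 1).tangent ∞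
    (fun z : Circle => (⟨z, ddt z⟩ : TangentBundle (𝓡 1) Circle)) := by
  let F₁ : Circle → TangentBundle 𝓘(ℝ, ℝ) ℝ × TangentBundle (𝓡 1) Circle :=
    fun z => (⟨(0 : ℝ), (1 : ℝ)⟩, ⟨z, 0⟩)
  have h₁ : ContMDiff (𝓡 1) (𝓘(ℝ, ℝ).tangent.prod (𝓡 1).tangent) ∞ F₁ :=
    contMDiff_const.prodMk (Bundle.contMDiff_zeroSection ℝ _)
  have h₂ := (contMDiff_equivTangentBundleProd_symm (n := ∞) (I := 𝓘(ℝ, ℝ)) (M := ℝ) (I' := 𝓡 1)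
    (M' := Circle)).comp h₁
  have h₃ := (contMDiff_exp_mul.contMDiff_tangentMap (m := ∞) (by simp)).comp h₂
  convert! h₃ using 1
  funext z
  have hcast : ∀ (p q : Circle) (a : EuclideanSpace ℝ (Fin 1)), p = q →
      (⟨p, a⟩ : TangentBundle (𝓡 1) Circle) = ⟨q, a⟩ := by
    rintro p q a rfl; rfl
  -- The tangent map lands over `Circle.exp 0 * z`, which equals `z` only propositionally, hence the
  -- transport.
  have hz : z = Circle.exp 0 * z := by simp
  refine (hcast _ _ (ddt z) hz).trans ?_
  have hd := mfderiv_prod_eq_add_apply (I := 𝓘(ℝ, ℝ)) (I' := 𝓡 1) (I'' := 𝓡 1) (p := ((0 : ℝ), z))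
    (v := ((1 : ℝ), (0 : EuclideanSpace ℝ (Fin 1))))
    (contMDiff_exp_mul.mdifferentiable (by simp) ((0 : ℝ), z))
  change (⟨Circle.exp 0 * z, ddt z⟩ : TangentBundle (𝓡 1) Circle) = ⟨Circle.exp 0 * z,
    mfderiv (𝓘(ℝ, ℝ).prod (𝓡 1)) (𝓡 1) (fun p : ℝ × Circle => Circle.exp p.1 * p.2) (0, z)
      ((1 : ℝ), (0 : EuclideanSpace ℝ (Fin 1)))⟩
  congr 1
  refine Eq.trans ?_ hd.symm
  refine Eq.trans ?_ (congrArg₂ (· + ·) rfl (map_zero _).symm)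
  exact (add_zero _).symm

/-- The curve `exp(is) z` has velocity `iz` at `0`, and `Im (z̄ · iz) = |z|² = 1`. -/
theorem dt_ddt (z : Circle) : dt z ![ddt z] = 1 := by
  have hcast : ∀ q : Circle, q = z → ∀ a : EuclideanSpace ℝ (Fin 1),
      (mfderiv (𝓡 1) 𝓘(ℝ, ℂ) (fun w : Circle => (w : ℂ)) q : _ →L[ℝ] ℂ) a =
      (mfderiv (𝓡 1) 𝓘(ℝ, ℂ) (fun w : Circle => (w : ℂ)) z : _ →L[ℝ] ℂ) a := by
    rintro q rfl a; rfl
  have hc : MDifferentiableAt 𝓘(ℝ, ℝ) (𝓡 1) (fun s : ℝ => Circle.exp s * z) 0 :=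
    (contMDiff_exp_mul.mdifferentiable (by simp) ((0 : ℝ), z)).comp 0
      (mdifferentiableAt_id.prodMk mdifferentiableAt_const)
  have h1 := mfderiv_comp (I := 𝓘(ℝ, ℝ)) (0 : ℝ)
    (contMDiff_circle_coe.mdifferentiable (by simp) (Circle.exp 0 * z)) hc
  rw [mfderiv_eq_fderiv] at h1
  have h2 : HasDerivAt ((fun w : Circle => (w : ℂ)) ∘ fun s : ℝ => Circle.exp s * z)
      (Complex.I * (z : ℂ)) 0 := by
    have h3 : HasDerivAt (fun s : ℝ => Complex.exp (s * Complex.I) * (z : ℂ)) (Complex.I * z) 0 := by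
      have := (((Complex.ofRealCLM.hasDerivAt (x := (0 : ℝ))).mul_const Complex.I).cexp).mul_const
        (z : ℂ)
      simpa using this
    refine h3.congr_of_eventuallyEq (Eventually.of_forall fun s => ?_)
    simp [Circle.coe_exp]
  have h5 : fderiv ℝ ((fun w : Circle => (w : ℂ)) ∘ fun s : ℝ => Circle.exp s * z) 0 1 =
      Complex.I * (z : ℂ) := by
    rw [fderiv_apply_one_eq_deriv, h2.deriv]
  let D : EuclideanSpace ℝ (Fin 1) →L[ℝ] ℂ :=
    mfderiv (𝓡 1) 𝓘(ℝ, ℂ) (fun w : Circle => (w : ℂ)) z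
  have h4 : D (ddt z) = Complex.I * (z : ℂ) := by
    refine (hcast _ (by simp : Circle.exp 0 * z = z) (ddt z)).symm.trans ?_
    refine (DFunLike.congr_fun h1 (1 : ℝ)).symm.trans ?_
    exact h5
  change (starRingEnd ℂ (z : ℂ) * D (ddt z)).im = 1
  rw [h4, mul_left_comm, ← Complex.normSq_eq_conj_mul_self, Circle.normSq_coe]
  simp

theorem eq_dt_smul_ddt (z : Circle) (a : TangentSpace (𝓡 1) z) : a = dt z ![a] • ddt z := by
  have hne : ddt z ≠ 0 := by
    intro h
    have h1 := dt_ddt z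
    have h0 := alternating_one_smul (dt z) 0 (ddt z)
    rw [zero_smul, zero_mul] at h0
    rw [h, h0] at h1
    exact zero_ne_one h1
  have hfr : Module.finrank ℝ (TangentSpace (𝓡 1) z) = 1 :=
    finrank_euclideanSpace_fin (𝕜 := ℝ) (n := 1)
  obtain ⟨c, rfl⟩ := (finrank_eq_one_iff_of_nonzero' (ddt z) hne).1 hfr a
  rw [alternating_one_smul, dt_ddt, mul_one]

end Circle

/-! ### Tools for building the frame: dimension count, momenta, products. -/

section Surjectivity

variable {E : Type*} [NormedAddCommGroup E] [NormedSpace ℝ E] [FiniteDimensional ℝ E]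
  {B : Type*} [TopologicalSpace B] {I : ModelWithCorners ℝ E B}
  {V : Type*} [TopologicalSpace V] [ChartedSpace B V]
  {E' : Type*} [NormedAddCommGroup E'] [NormedSpace ℝ E'] [FiniteDimensional ℝ E']
  {B' : Type*} [TopologicalSpace B'] {I' : ModelWithCorners ℝ E' B'}
  {W : Type*} [TopologicalSpace W] [ChartedSpace B' W]

/-- An injective frame between spaces of equal dimension is bijective, so only injectivity needs a
geometric argument. -/
theorem exists_frame_eq (hfin : Module.finrank ℝ E' = Module.finrank ℝ E + 2) {π : W → V}
    {pt : W → ℝ} {τ : Form I' W 1} {x : W}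
    (hinj : ∀ v : TangentSpace I' x, mfderiv I' I π x v = 0 → differential pt x v = 0 →
      τ x ![v] = 0 → v = 0) (a : TangentSpace I (π x)) (s t : ℝ) :
    ∃ v : TangentSpace I' x, mfderiv I' I π x v = a ∧ differential pt x v = s ∧ τ x ![v] = t := by
  let A : E' →ₗ[ℝ] E := (mfderiv I' I π x : E' →L[ℝ] E).toLinearMap
  let b : E' →ₗ[ℝ] ℝ := (differential (I := I') pt x : E' →L[ℝ] ℝ).toLinearMap
  let c : E' →ₗ[ℝ] ℝ := ((ContinuousAlternatingMap.ofSubsingleton ℝ E' ℝ (0 : Fin 1)).symm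
    (τ x : E' [⋀^Fin 1]→L[ℝ] ℝ)).toLinearMap
  have hc : ∀ v : E', c v = τ x ![(v : TangentSpace I' x)] := by
    intro v
    change τ x _ = τ x _
    congr 1
    funext i
    fin_cases i; rfl
  let L : E' →ₗ[ℝ] E × ℝ × ℝ := A.prod (b.prod c)
  have hL : Function.Injective L := by
    rw [injective_iff_map_eq_zero]
    intro v hv
    refine hinj v (congrArg Prod.fst hv) (congrArg (fun z => z.2.1) hv) ?_
    exact (hc v).symm.trans (congrArg (fun z => z.2.2) hv)
  have hs : Function.Surjective L := by
    refine (LinearMap.injective_iff_surjective_of_finrank_eq_finrank ?_).1 hL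
    rw [hfin, Module.finrank_prod, Module.finrank_prod, Module.finrank_self]
  obtain ⟨v, hv⟩ := hs (a, s, t)
  exact ⟨v, congrArg Prod.fst hv, congrArg (fun z => z.2.1) hv,
    (hc v).symm.trans (congrArg (fun z => z.2.2) hv)⟩

end Surjectivity

section Momentum

variable {E : Type*} [NormedAddCommGroup E] [NormedSpace ℝ E]
  {B : Type*} [TopologicalSpace B] {I : ModelWithCorners ℝ E B}
  {M : Type*} [TopologicalSpace M] [ChartedSpace B M] [IsManifold I ∞ M]

/-- The momentum along a smooth vector field is a smooth function on the cotangent bundle. -/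
theorem contMDiff_covector_apply {X : ∀ x : M, TangentSpace I x}
    (hX : ContMDiff I I.tangent ∞ (fun x => (⟨x, X x⟩ : TangentBundle I M))) :
    ContMDiff (cotangentModel I) 𝓘(ℝ, ℝ) ∞
      (fun P : CotangentBundle I M => P.covector (X P.proj)) := by
  intro P
  have hid : ContMDiffAt (cotangentModel I) (cotangentModel I) ∞
      (fun Q : CotangentBundle I M => Q) P := contMDiffAt_id
  have hv : ContMDiffAt (cotangentModel I) I.tangent ∞
      (fun Q : CotangentBundle I M => (⟨Q.proj, X Q.proj⟩ : TangentBundle I M)) P :=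
    (hX P.proj).comp P (Bundle.contMDiff_proj _ P)
  have h := ContMDiffAt.clm_bundle_apply (ϕ := fun Q : CotangentBundle I M => Q.2) hid hv
  exact (Bundle.contMDiffAt_totalSpace.1 h).2

end Momentum

section Product

variable {E : Type*} [NormedAddCommGroup E] [NormedSpace ℝ E]
  {B : Type*} [TopologicalSpace B] {I : ModelWithCorners ℝ E B}
  {V : Type*} [TopologicalSpace V] [ChartedSpace B V]
  {F : Type*} [NormedAddCommGroup F] [NormedSpace ℝ F]
  {C : Type*} [TopologicalSpace C] {J : ModelWithCorners ℝ F C}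
  {N : Type*} [TopologicalSpace N] [ChartedSpace C N]
  {G : Type*} [NormedAddCommGroup G] [NormedSpace ℝ G]
  {D : Type*} [TopologicalSpace D] {K : ModelWithCorners ℝ G D}
  {Z : Type*} [TopologicalSpace Z] [ChartedSpace D Z]

theorem eq_zero_of_mfderiv_fst_snd {x : V × N} {v : TangentSpace (I.prod J) x}
    (h1 : mfderiv (I.prod J) I Prod.fst x v = 0) (h2 : mfderiv (I.prod J) J Prod.snd x v = 0) :
    v = 0 := by
  rw [mfderiv_fst] at h1
  rw [mfderiv_snd] at h2
  exact Prod.ext h1 h2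

theorem Form.pullback_comp {f : V → N} {g : N → Z} (σ : Form K Z 1) {x : V}
    (hg : MDifferentiableAt J K g (f x)) (hf : MDifferentiableAt I J f x) :
    (Form.pullback (fun y => g (f y)) σ : Form I V 1) x =
      (Form.pullback f (Form.pullback g σ : Form J N 1) : Form I V 1) x := by
  ext v
  change σ (g (f x)) _ = σ (g (f x)) _
  congr 1
  funext i
  exact DFunLike.congr_fun (mfderiv_comp x hg hf) (v i)

theorem differential_comp_map {f : V → N} {p : N → ℝ} {x : V}
    (hp : MDifferentiableAt J 𝓘(ℝ, ℝ) p (f x)) (hf : MDifferentiableAt I J f x)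
    (v : TangentSpace I x) :
    differential (fun y => p (f y)) x v = differential p (f x) (mfderiv I J f x v) :=
  DFunLike.congr_fun (mfderiv_comp x hp hf) v

/-- The product of `V` with a surface on which `σ'' = d(pt) ∧ τ` is nondegenerate. -/
theorem isSuspension_prod [FiniteDimensional ℝ E] [I.Boundaryless] [IsManifold I ∞ V]
    [FiniteDimensional ℝ F] [J.Boundaryless] [IsManifold J ∞ N]
    (hdim : Module.finrank ℝ F = 2) (σ : Form I V 2) {σ'' : Form J N 2} {p : N → ℝ}
    {τ : Form J N 1} (hp : ContMDiff J 𝓘(ℝ, ℝ) ∞ p) (hτ : τ.SmoothOn univ) (hd : τ.d = 0)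
    (hσ : ∀ x (v w : TangentSpace J x), σ'' x ![v, w] =
      differential p x v * τ x ![w] - τ x ![v] * differential p x w)
    (hnd : ∀ x (v : TangentSpace J x), (∀ w : TangentSpace J x, σ'' x ![v, w] = 0) → v = 0) :
    IsSuspension σ
      (Form.pullback Prod.fst σ + Form.pullback Prod.snd σ'' : Form (I.prod J) (V × N) 2)
      Prod.fst (fun w => p w.2) (Form.pullback Prod.snd τ) := by
  have hdp (x : V × N) (v : TangentSpace (I.prod J) x) :
      differential (fun w : V × N => p w.2) x v =
        differential p x.2 (mfderiv (I.prod J) J Prod.snd x v) :=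
    differential_comp_map (hp.mdifferentiable (by simp) x.2) mdifferentiableAt_snd v
  have hinj (x : V × N) (v : TangentSpace (I.prod J) x)
      (h1 : mfderiv (I.prod J) I Prod.fst x v = 0)
      (h2 : differential (fun w : V × N => p w.2) x v = 0)
      (h3 : (Form.pullback Prod.snd τ : Form (I.prod J) (V × N) 1) x ![v] = 0) : v = 0 := by
    -- A vector of the surface killed by `dp` and `τ` is in the kernel of `dp ∧ τ`, which is
    -- nondegenerate.
    refine eq_zero_of_mfderiv_fst_snd h1 (hnd x.2 _ fun w => ?_)
    rw [Form.pullback_apply_one] at h3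
    rw [hσ, ← hdp, h2, h3]
    ring
  refine ⟨contMDiff_fst, hp.comp contMDiff_snd,
    fun x _ => Form.SmoothAt.pullback (hτ x.2 trivial) (contMDiff_snd x), ?_, fun x v w => ?_, hinj,
    fun x a s t => exists_frame_eq ?_ (hinj x) a s t⟩
  · funext x
    rw [Form.d_pullback (hτ x.2 trivial) (contMDiff_snd x), hd]
    rfl
  · rw [Form.add_apply, Form.pullback_apply_two, Form.pullback_apply_two, Form.pullback_apply_one,
      Form.pullback_apply_one, hσ, hdp, hdp, add_sub_assoc]
  · rw [Module.finrank_prod, hdim]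

end Product

/-! ### The frame on `V × T*S¹`. -/

section CircleCotangent

/-- The form `dt` on `T*S¹`. -/
def circleDt : Form (cotangentModel (𝓡 1)) CotCircle 1 := Form.pullback (fun Q => Q.proj) dt

theorem circleDt_smoothAt (P : CotCircle) : circleDt.SmoothAt P :=
  (dt_smoothAt _).pullback (CotangentBundle.contMDiff_proj P)

theorem d_circleDt : circleDt.d = 0 := by
  funext P
  rw [circleDt, Form.d_pullback (dt_smoothAt _) (CotangentBundle.contMDiff_proj P), d_dt]
  rfl

theorem contMDiff_circleMomentum :
    ContMDiff (cotangentModel (𝓡 1)) 𝓘(ℝ, ℝ) ∞ circleMomentum :=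
  contMDiff_covector_apply contMDiff_ddt

/-- Every tangent vector of the circle is `dt(a) ∂_t`, so a covector is its value on `∂_t` times
`dt`. -/
theorem liouville_circle :
    liouville (𝓡 1) Circle = fun P => circleMomentum P • circleDt P := by
  funext P
  refine Form.ext_one (τ := fun Q : CotCircle => circleMomentum Q • circleDt Q) fun v => ?_
  refine (liouville_apply P v).trans ((Form.smul_apply circleMomentum circleDt P _).trans ?_).symm
  rw [circleDt, Form.pullback_apply_one]
  refine Eq.symm ((congrArg P.covector (eq_dt_smul_ddt P.proj _)).trans
    ((map_smul P.covector _ _).trans ?_))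
  exact mul_comm _ _

theorem canonicalForm_circle_apply (P : CotCircle)
    (v w : TangentSpace (cotangentModel (𝓡 1)) P) :
    canonicalForm (𝓡 1) Circle P ![v, w] =
      differential circleMomentum P v * circleDt P ![w] -
        circleDt P ![v] * differential circleMomentum P w := by
  rw [canonicalForm, liouville_circle,
    Form.d_smul_apply (contMDiff_circleMomentum P) (circleDt_smoothAt P), d_circleDt]
  change _ - _ + _ * (0 : ℝ) = _
  ring

theorem isSuspension_prodForm {E : Type*} [NormedAddCommGroup E] [NormedSpace ℝ E]
    [FiniteDimensional ℝ E] {B : Type*} [TopologicalSpace B] {I : ModelWithCorners ℝ E B}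
    [I.Boundaryless] {V : Type*} [TopologicalSpace V] [ChartedSpace B V] [IsManifold I ∞ V]
    (σ : Form I V 2) : IsSuspension σ (prodForm σ) Prod.fst
      (fun w : V × CotCircle => circleMomentum w.2) (prodDt I V) := by
  have h : prodDt I V = Form.pullback Prod.snd circleDt := by
    funext x
    exact Form.pullback_comp (I := I.prod (cotangentModel (𝓡 1))) dt
      (CotangentBundle.contMDiff_proj.mdifferentiable (by simp) x.2) mdifferentiableAt_snd
  rw [h]
  refine isSuspension_prod ?_ σ contMDiff_circleMomentum (fun P _ => circleDt_smoothAt P)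
    d_circleDt canonicalForm_circle_apply canonicalForm_nondegenerate
  rw [Module.finrank_prod, finrank_strongDual]
  simp

end CircleCotangent

/-! ### The frame on `T*(M × S¹)`. -/

section ProductChart

variable {E : Type*} [NormedAddCommGroup E] [NormedSpace ℝ E]
  {B : Type*} [TopologicalSpace B] {I : ModelWithCorners ℝ E B} [I.Boundaryless]
  {V : Type*} [TopologicalSpace V] [ChartedSpace B V] [IsManifold I ∞ V]
  {F : Type*} [NormedAddCommGroup F] [NormedSpace ℝ F]
  {C : Type*} [TopologicalSpace C] {J : ModelWithCorners ℝ F C} [J.Boundaryless]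
  {N : Type*} [TopologicalSpace N] [ChartedSpace C N] [IsManifold J ∞ N]

theorem mfderiv_extChartAt_symm_prod {x : V × N} {y : E × F}
    (hy : y ∈ (extChartAt (I.prod J) x).target) (w : E × F) :
    (mfderiv 𝓘(ℝ, E × F) (I.prod J) (extChartAt (I.prod J) x).symm y : E × F →L[ℝ] E × F) w =
      ((mfderiv 𝓘(ℝ, E) I (extChartAt I x.1).symm y.1 : E →L[ℝ] E) w.1,
        (mfderiv 𝓘(ℝ, F) J (extChartAt J x.2).symm y.2 : F →L[ℝ] F) w.2) := by
  have e : ((extChartAt (I.prod J) x).symm : E × F → V × N) =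
      fun z => ((extChartAt I x.1).symm z.1, (extChartAt J x.2).symm z.2) := by
    rw [extChartAt_prod]
    rfl
  rw [extChartAt_prod] at hy
  have h1 : MDifferentiableAt 𝓘(ℝ, E) I (extChartAt I x.1).symm y.1 :=
    mdifferentiableAt_extChartAt_symm hy.1
  have h2 : MDifferentiableAt 𝓘(ℝ, F) J (extChartAt J x.2).symm y.2 :=
    mdifferentiableAt_extChartAt_symm hy.2
  have f1 : MDifferentiableAt 𝓘(ℝ, E × F) 𝓘(ℝ, E) (fun z : E × F => z.1) y :=
    differentiableAt_fst.mdifferentiableAt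
  have f2 : MDifferentiableAt 𝓘(ℝ, E × F) 𝓘(ℝ, F) (fun z : E × F => z.2) y :=
    differentiableAt_snd.mdifferentiableAt
  have c1 := mfderiv_comp y h1 f1
  have c2 := mfderiv_comp y h2 f2
  rw [mfderiv_eq_fderiv, fderiv_fst] at c1
  rw [mfderiv_eq_fderiv, fderiv_snd] at c2
  rw [e]
  refine (DFunLike.congr_fun (mfderiv_prodMk (h1.comp y f1) (h2.comp y f2)) w).trans ?_
  exact Prod.ext (DFunLike.congr_fun c1 w) (DFunLike.congr_fun c2 w)

theorem Form.d_pullback_add_smul_apply {π : V → N} {σ : Form J N 1} {p : V → ℝ} {τ : Form I V 1}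
    {x : V} (hσ : σ.SmoothAt (π x)) (hπ : ContMDiffAt I J ∞ π x)
    (hp : ContMDiffAt I 𝓘(ℝ, ℝ) ∞ p x) (hτ : τ.SmoothAt x) (hd : τ.d x = 0)
    (v w : TangentSpace I x) :
    (Form.pullback π σ + fun y => p y • τ y : Form I V 1).d x ![v, w] =
      σ.d (π x) ![mfderiv I J π x v, mfderiv I J π x w] +
        differential p x v * τ x ![w] - τ x ![v] * differential p x w := by
  rw [Form.d_add (hσ.pullback hπ) (Form.SmoothAt.smul hp hτ), Form.d_pullback hσ hπ]
  refine (congrArg₂ (· + ·) (Form.pullback_apply_two π σ.d x v w)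
    (Form.d_smul_apply hp hτ v w)).trans ?_
  rw [hd]
  change _ + (_ - _ + _ * (0 : ℝ)) = _
  ring

end ProductChart

section CotangentProduct

variable {E : Type*} [NormedAddCommGroup E] [NormedSpace ℝ E]
  {B : Type*} [TopologicalSpace B] {I : ModelWithCorners ℝ E B}
  {M : Type*} [TopologicalSpace M] [ChartedSpace B M]

theorem covector_apply (P : CotangentBundle (I.prod (𝓡 1)) (M × Circle))
    (a : TangentSpace (I.prod (𝓡 1)) P.proj) :
    P.covector a = (cotProj I M P).covector (mfderiv (I.prod (𝓡 1)) I Prod.fst P.proj a) +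
      cotMomentum I M P *
        dt P.proj.2 ![mfderiv (I.prod (𝓡 1)) (𝓡 1) Prod.snd P.proj a] := by
  rw [mfderiv_fst, mfderiv_snd, mul_comm]
  let a' : TangentSpace I P.proj.1 × TangentSpace (𝓡 1) P.proj.2 := a
  let L : (TangentSpace I P.proj.1 × TangentSpace (𝓡 1) P.proj.2) →L[ℝ] ℝ := P.covector
  have h : a' = (a'.1, 0) + dt P.proj.2 ![a'.2] •
      ((0, ddt P.proj.2) : TangentSpace I P.proj.1 × TangentSpace (𝓡 1) P.proj.2) := by
    refine Prod.ext ?_ ?_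
    · simp
    · simpa using eq_dt_smul_ddt P.proj.2 a'.2
  refine (congrArg L h).trans ((map_add L _ _).trans ?_)
  exact congrArg₂ (· + ·) rfl (map_smul L _ _)

variable [IsManifold I ∞ M]

theorem contMDiff_cotMomentum : ContMDiff (cotangentModel (I.prod (𝓡 1))) 𝓘(ℝ, ℝ) ∞
    (cotMomentum I M) := by
  refine contMDiff_covector_apply (I := I.prod (𝓡 1)) (M := M × Circle)
    (X := fun x => ((0, ddt x.2) : TangentSpace I x.1 × TangentSpace (𝓡 1) x.2)) ?_
  have h1 : ContMDiff (I.prod (𝓡 1)) I.tangent ∞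
      (fun x : M × Circle => (⟨x.1, 0⟩ : TangentBundle I M)) :=
    (Bundle.contMDiff_zeroSection ℝ (TangentSpace I : M → Type _)).comp contMDiff_fst
  have h2 : ContMDiff (I.prod (𝓡 1)) (𝓡 1).tangent ∞
      (fun x : M × Circle => (⟨x.2, ddt x.2⟩ : TangentBundle (𝓡 1) Circle)) :=
    contMDiff_ddt.comp contMDiff_snd
  exact contMDiff_equivTangentBundleProd_symm.comp (h1.prodMk h2)

variable [I.Boundaryless]

/-- In bundle charts `cotProj` restricts a momentum to the `M`-directions, a fixed linear operation;
hence it is smooth. -/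
theorem CotangentBundle.fiberCoord_cotProj {x : M × Circle}
    {P : CotangentBundle (I.prod (𝓡 1)) (M × Circle)}
    (hP : P.proj ∈ (extChartAt (I.prod (𝓡 1)) x).source) :
    (cotProj I M P).fiberCoord x.1 =
      (P.fiberCoord x).comp (ContinuousLinearMap.inl ℝ E (EuclideanSpace ℝ (Fin 1))) := by
  have hP' : P.proj.1 ∈ (extChartAt I x.1).source := by
    rw [extChartAt_prod] at hP
    exact hP.1
  have e : extChartAt (I.prod (𝓡 1)) x P.proj =
      (extChartAt I x.1 P.proj.1, extChartAt (𝓡 1) x.2 P.proj.2) := by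
    rw [extChartAt_prod]
    rfl
  ext w
  refine ((cotProj I M P).fiberCoord_apply hP' w).trans (Eq.trans ?_ (P.fiberCoord_apply hP _).symm)
  refine congrArg P.covector ?_
  refine Eq.trans ?_ (mfderiv_extChartAt_symm_prod ((extChartAt _ x).map_source hP) _).symm
  rw [e]
  exact Prod.ext rfl (map_zero _).symm

theorem contMDiff_cotProj :
    ContMDiff (cotangentModel (I.prod (𝓡 1))) (cotangentModel I) ∞ (cotProj I M) := by
  intro P
  refine Bundle.contMDiffAt_totalSpace.2 ⟨?_, ?_⟩
  · exact (contMDiff_fst.comp CotangentBundle.contMDiff_proj) P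
  · have h1 : ContMDiffAt (cotangentModel (I.prod (𝓡 1)))
        𝓘(ℝ, (E × EuclideanSpace ℝ (Fin 1)) →L[ℝ] ℝ) ∞
        (fun Q : CotangentBundle (I.prod (𝓡 1)) (M × Circle) => Q.fiberCoord P.proj) P :=
      (Bundle.contMDiffAt_totalSpace.1 contMDiffAt_id).2
    have h2 : ContMDiffAt (cotangentModel (I.prod (𝓡 1))) 𝓘(ℝ, E →L[ℝ] ℝ) ∞
        (fun Q : CotangentBundle (I.prod (𝓡 1)) (M × Circle) => (Q.fiberCoord P.proj).comp
          (ContinuousLinearMap.inl ℝ E (EuclideanSpace ℝ (Fin 1)))) P :=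
      h1.clm_comp contMDiffAt_const
    refine h2.congr_of_eventuallyEq ?_
    have hs : ∀ᶠ Q in 𝓝 P, Q.proj ∈ (extChartAt (I.prod (𝓡 1)) P.proj).source :=
      CotangentBundle.contMDiff_proj.continuous.continuousAt.eventually
        (extChartAt_source_mem_nhds P.proj)
    filter_upwards [hs] with Q hQ
    exact CotangentBundle.fiberCoord_cotProj hQ

theorem cotDt_smoothAt (P : CotangentBundle (I.prod (𝓡 1)) (M × Circle)) :
    (cotDt I M).SmoothAt P :=
  (dt_smoothAt _).pullback ((contMDiff_snd.comp CotangentBundle.contMDiff_proj) P)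

theorem d_cotDt : (cotDt I M).d = 0 := by
  funext P
  have h : ContMDiffAt (cotangentModel (I.prod (𝓡 1))) (𝓡 1) ∞
      (fun Q : CotangentBundle (I.prod (𝓡 1)) (M × Circle) => Q.proj.2) P :=
    (contMDiff_snd.comp CotangentBundle.contMDiff_proj) P
  rw [cotDt, Form.d_pullback (dt_smoothAt _) h, d_dt]
  rfl

/-- Splitting a tangent vector of `M × S¹` into its two factors splits the covector into its
restriction to `M` and `p_t dt`. Differentiating gives the required shape of the symplectic form,
since `dt` is closed. -/
theorem liouville_prod_circle : liouville (I.prod (𝓡 1)) (M × Circle) =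
    Form.pullback (cotProj I M) (liouville I M) +
      fun P => cotMomentum I M P • cotDt I M P := by
  funext P
  refine Form.ext_one (τ := Form.pullback (cotProj I M) (liouville I M) +
      fun P => cotMomentum I M P • cotDt I M P) fun v => ?_
  refine (liouville_apply P v).trans ?_
  rw [Form.add_apply, Form.smul_apply, covector_apply, cotDt, Form.pullback_apply_one,
    Form.pullback_apply_one, liouville_apply]
  have hp : MDifferentiableAt (cotangentModel (I.prod (𝓡 1))) (I.prod (𝓡 1))
      (fun Q : CotangentBundle (I.prod (𝓡 1)) (M × Circle) => Q.proj) P :=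
    CotangentBundle.contMDiff_proj.mdifferentiable (by simp) P
  have h1 := DFunLike.congr_fun (mfderiv_comp P (mdifferentiableAt_fst (I := I) (I' := 𝓡 1)) hp) v
  have h2 := DFunLike.congr_fun (mfderiv_comp P (mdifferentiableAt_snd (I := I) (I' := 𝓡 1)) hp) v
  have h3 := DFunLike.congr_fun (mfderiv_comp P
    ((CotangentBundle.contMDiff_proj (I := I)).mdifferentiable (by simp) (cotProj I M P))
    (contMDiff_cotProj.mdifferentiable (by simp) P)) v
  -- The two routes from `T*(M × S¹)` to `M`, through `M × S¹` and through `T*M`, are the same map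
  -- by definition.
  refine congrArg₂ (· + ·) (congrArg (cotProj I M P).covector (h1.symm.trans h3))
    (congrArg₂ (· * ·) rfl (congrArg (fun b => dt P.proj.2 ![b]) h2.symm))

theorem canonicalForm_prod_circle_apply (P : CotangentBundle (I.prod (𝓡 1)) (M × Circle))
    (v w : TangentSpace (cotangentModel (I.prod (𝓡 1))) P) :
    canonicalForm (I.prod (𝓡 1)) (M × Circle) P ![v, w] =
      canonicalForm I M (cotProj I M P)
        ![mfderiv (cotangentModel (I.prod (𝓡 1))) (cotangentModel I) (cotProj I M) P v,
          mfderiv (cotangentModel (I.prod (𝓡 1))) (cotangentModel I) (cotProj I M) P w] +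
      differential (cotMomentum I M) P v * cotDt I M P ![w] -
        cotDt I M P ![v] * differential (cotMomentum I M) P w := by
  have h := Form.d_pullback_add_smul_apply (liouville_smoothAt (cotProj I M P))
    (contMDiff_cotProj (I := I) (M := M) P) (contMDiff_cotMomentum P) (cotDt_smoothAt P)
    (congrFun d_cotDt P) v w
  rwa [← liouville_prod_circle] at h

theorem isSuspension_cotangentBundle [FiniteDimensional ℝ E] :
    IsSuspension (canonicalForm I M) (canonicalForm (I.prod (𝓡 1)) (M × Circle)) (cotProj I M)
      (cotMomentum I M) (cotDt I M) := by
  have hinj (P : CotangentBundle (I.prod (𝓡 1)) (M × Circle))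
      (v : TangentSpace (cotangentModel (I.prod (𝓡 1))) P)
      (h1 : mfderiv (cotangentModel (I.prod (𝓡 1))) (cotangentModel I) (cotProj I M) P v = 0)
      (h2 : differential (cotMomentum I M) P v = 0) (h3 : cotDt I M P ![v] = 0) : v = 0 := by
    -- A vector killed by the whole frame is killed by the symplectic form written in that frame.
    refine canonicalForm_nondegenerate P v fun w => ?_
    rw [canonicalForm_prod_circle_apply, h1, h2, h3, ← bilin_apply, map_zero]
    simp
  refine ⟨contMDiff_cotProj, contMDiff_cotMomentum, fun P _ => cotDt_smoothAt P, d_cotDt,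
    canonicalForm_prod_circle_apply, hinj, fun P a s t => exists_frame_eq ?_ (hinj P) a s t⟩
  simp only [Module.finrank_prod, finrank_strongDual, finrank_euclideanSpace_fin]
  ring

end CotangentProduct

end StableSuspension

end

theorem mainTheorem3 :
    -- the convex suspension on `T*(M × S¹)`
    (∀ {E : Type*} [NormedAddCommGroup E] [NormedSpace ℝ E] [FiniteDimensional ℝ E]
        {B : Type*} [TopologicalSpace B] (I : ModelWithCorners ℝ E B) [I.Boundaryless]
        (M : Type*) [TopologicalSpace M] [ChartedSpace B M] [IsManifold I ∞ M]
        (H : CotangentBundle I M → ℝ) (_ : ContMDiff (cotangentModel I) 𝓘(ℝ, ℝ) ∞ H)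
        (k δ : ℝ) (_ : 0 < δ) (α : Form (cotangentModel I) (CotangentBundle I M) 1)
        (_ : IsAdapted (canonicalForm I M) H k δ α),
        IsStableLevel (canonicalForm (I.prod (𝓡 1)) (M × Circle)) (cotSuspension H) k ∧
        ((H ⁻¹' {k}).Nonempty → ∃ ε : ℝ, 0 < ε ∧ ε < √(2 * δ) ∧ ∃ f r : ℝ → ℝ,
          IsCutoff ε f ∧ IsLevelValue (canonicalForm I M) H k ε α r) ∧
        ∀ ε : ℝ, 0 < ε → ε < √(2 * δ) → ∀ f r : ℝ → ℝ,
          IsCutoff ε f → IsLevelValue (canonicalForm I M) H k ε α r →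
          ContDiff ℝ ∞ (gFun r f) ∧
          Stabilizes (canonicalForm (I.prod (𝓡 1)) (M × Circle)) (cotSuspension H) k
            (suspensionForm f (gFun r f) (cotMomentum I M) (cotProj I M) α (cotDt I M))) ∧
    -- the convex suspension on `V × T*S¹`, for a symplectic manifold `V`
    (∀ {E : Type*} [NormedAddCommGroup E] [NormedSpace ℝ E] [FiniteDimensional ℝ E]
        {B : Type*} [TopologicalSpace B] (I : ModelWithCorners ℝ E B) [I.Boundaryless]
        (V : Type*) [TopologicalSpace V] [ChartedSpace B V] [IsManifold I ∞ V]
        (σ : Form I V 2) (_ : IsSymplectic σ)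
        (H : V → ℝ) (_ : ContMDiff I 𝓘(ℝ, ℝ) ∞ H)
        (k δ : ℝ) (_ : 0 < δ) (α : Form I V 1) (_ : IsAdapted σ H k δ α),
        IsStableLevel (prodForm σ) (prodSuspension H) k ∧
        ((H ⁻¹' {k}).Nonempty → ∃ ε : ℝ, 0 < ε ∧ ε < √(2 * δ) ∧ ∃ f r : ℝ → ℝ,
          IsCutoff ε f ∧ IsLevelValue σ H k ε α r) ∧
        ∀ ε : ℝ, 0 < ε → ε < √(2 * δ) → ∀ f r : ℝ → ℝ,
          IsCutoff ε f → IsLevelValue σ H k ε α r →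
          ContDiff ℝ ∞ (gFun r f) ∧
          Stabilizes (prodForm σ) (prodSuspension H) k
            (suspensionForm f (gFun r f) (fun w => circleMomentum w.2) Prod.fst α
              (prodDt I V))) := by
  refine ⟨?_, ?_⟩
  · intro E _ _ _ B _ I _ M _ _ _ H hH k δ hδ α hα
    exact isSuspension_cotangentBundle.main canonicalForm_nondegenerate canonicalForm_smoothOn hH
      hδ hα
  · intro E _ _ _ B _ I _ V _ _ _ σ hσ H hH k δ hδ α hα
    exact (isSuspension_prodForm σ).main hσ.nondegenerate hσ.smooth hH hδ hα
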